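/- Let $a>2$ and $\alpha_0\in[0,1)$. For every sample size $n$ let $\mathbf y=\mathbf X\boldsymbol\beta_0+\boldsymbol\varepsilon$ be a linear model with a (random or fixed) $n\times p$ design matrix $\mathbf X=(X_{ij})$, $p=p_n$, and a coefficient vector $\boldsymbol\beta_0=\boldsymbol\beta_{0,n}\in\mathbb R^p$. Let $M_0=\{j:\beta_{0j}\ne0\}$, $s=|M_0|$, $d_n=\frac12\min_{j\in M_0}|\beta_{0j}|$ ($d_n=+\infty$ if $M_0=\emptyset$), and let $\mathbf X_1$, $\mathbf X_2$ be the submatrices of $\mathbf X$ of the columns with index in $M_0$ and outside $M_0$. For $\lambda>0$ let $\rho_\lambda$ be the SCAD penalty, i.e. $\rho_\lambda(0)=0$ and $$\rho_\lambda'(t)=\lambda\Big\{I(t\le\lambda)+\frac{(a\lambda-t)_+}{(a-1)\lambda}I(t>\lambda)\Big\},\qquad t\ge0,$$ and let $$Q_{n,\lambda}(\boldsymbol\beta)=\|\mathbf y-\mathbf X\boldsymbol\beta\|_2^2+2n\sum_{j=1}^p\rho_\lambda(|\beta_j|).$$ Assume that $\log p=O(n^{\alpha_0})$, $s=O(n^{\alpha_0})$,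 and: (A1) the errors $\varepsilon_1,\dots,\varepsilon_n$ are i.i.d. with a law that does not depend on $n$, with mean $0$ and finite variance $\sigma^2$, and are independent of $\mathbf X$; either (A3) there is a constant $L$ with $|X_{ij}|\le L$ almost surely for all $n,i,j$, and (A4) $E\exp(|\varepsilon_1|/A)\le b$ for some finite $A,b>0$; or (A5) the rows of $\mathbf X$ are i.i.d. and there are constants $\alpha>1$, $\rho,L>0$ with $E\exp\{(|X_{ij}|/\rho)^{\alpha}\}\le L$ for all $n,i,j$, and (A6) $E\exp\{(|\varepsilon_1|/A)^\theta\}\le b$ for some finite $A,b,\theta>0$ with $1/\alpha+1/\theta\le1$; (A8) there are constants $0<c_1,c_2<\infty$ with $P\{\lambda_{\min}(\frac1n\mathbf X_1^T\mathbf X_1)\ge c_1\}\to1$ and $P\{\|\frac1n\mathbf X_2^T\mathbf X_1\|_{2,\infty}\le c_2\}\to1$, where $\|\mathbf B\|_{2,\infty}=\max_{\|v\|_2\le1}\|\mathbf Bv\|_\infty$; (A9) $d_n\ge n^{-\gamma}\log n$ for all large $n$, for some $\gamma\in(0,1/2]$; the deterministic levels $\lambda_n$ are of exact order $n^{-(1-\alpha_0)/2}\log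 n$ (their ratio to it lies between two positive constants for all large $n$); and $\lambda_n/d_n\to0$. Then there are measurable functions $\hat{\boldsymbol\beta}_n=\hat{\boldsymbol\beta}_n(\mathbf X,\mathbf y)\in\mathbb R^p$ such that 1. with probability tending to one, $\hat{\boldsymbol\beta}_n$ is a strict local minimizer of $Q_{n,\lambda_n}$ and $\{j:\hat\beta_{n,j}\ne0\}=M_0$; 2. with this same $\hat{\boldsymbol\beta}_n$ and $\hat s=\#\{j:\hat\beta_{n,j}\ne0\}$, the estimator $\hat\sigma^2_{\mathrm{SCAD}}=\frac1{n-\hat s}\|\mathbf y-\mathbf X\hat{\boldsymbol\beta}_n\|_2^2$ satisfies, with $E\varepsilon_1^4<\infty$, $$\sqrt n\,(\hat\sigma^2_{\mathrm{SCAD}}-\sigma^2)\xrightarrow{\ \mathcal D\ }N(0,\,E\varepsilon_1^4-\sigma^4).$$ -/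

import Mathlib

open MeasureTheory ProbabilityTheory Filter Topology
open scoped ENNReal Matrix

noncomputable section

namespace SCAD

/-! ### The penalized least squares problem -/

/-- The derivative of the SCAD penalty with shape parameter `a` and regularization level `lam`,
at a point `t ≥ 0`. -/
def penaltyDeriv (a lam t : ℝ) : ℝ :=
  lam * ((if t ≤ lam then 1 else 0) +
    max (a * lam - t) 0 / ((a - 1) * lam) * (if lam < t then 1 else 0))

/-- The SCAD penalty on `[0, ∞)`: the function vanishing at `0` with derivative
`penaltyDeriv a lam`. -/
def penalty (a lam t : ℝ) : ℝ := ∫ u in (0 : ℝ)..t, penaltyDeriv a lam u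

/-- The SCAD objective `‖y - X β‖² + 2 n ∑ⱼ ρ_lam(|βⱼ|)`. -/
def objective {n p : ℕ} (a lam : ℝ) (X : Matrix (Fin n) (Fin p) ℝ) (y : Fin n → ℝ)
    (β : Fin p → ℝ) : ℝ :=
  ∑ i, (y i - (X *ᵥ β) i) ^ 2 + 2 * (n : ℝ) * ∑ j, penalty a lam |β j|

/-- `b` is a strict local minimizer of `f`. -/
def IsStrictLocalMin {E : Type*} [TopologicalSpace E] (f : E → ℝ) (b : E) : Prop :=
  ∀ᶠ b' in 𝓝[≠] b, f b < f b'

/-- The set of indices of the nonzero coefficients. -/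
def model {p : ℕ} (β : Fin p → ℝ) : Set (Fin p) := {j | β j ≠ 0}

/-- The plug-in variance estimator `(n - ŝ)⁻¹ ∑ᵢ (yᵢ - xᵢᵀ b)²`, with `ŝ` the number of nonzero
coefficients of `b`. -/
def plugInVariance {n p : ℕ} (X : Matrix (Fin n) (Fin p) ℝ) (y : Fin n → ℝ)
    (b : Fin p → ℝ) : ℝ :=
  (∑ i, (y i - (X *ᵥ b) i) ^ 2) / ((n : ℝ) - ((model b).ncard : ℝ))

/-! ### Matrix quantities -/

/-- The smallest eigenvalue of a symmetric real matrix (`+∞` for the empty matrix). -/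
def lambdaMin {ι : Type*} [Fintype ι] [DecidableEq ι] (A : Matrix ι ι ℝ) : EReal :=
  ⨅ μ ∈ spectrum ℝ A, (μ : EReal)

/-- The norm `‖B‖_{2,∞} = max {‖B v‖_∞ : ‖v‖₂ ≤ 1}`; the function type `κ → ℝ` carries the
sup-norm. -/
def normTwoInfty {κ ι : Type*} [Fintype κ] [Fintype ι] (B : Matrix κ ι ℝ) : ℝ≥0∞ :=
  ⨆ (v : EuclideanSpace ℝ ι) (_ : ‖v‖ ≤ 1), ‖B *ᵥ v.ofLp‖ₑ

/-- The submatrix of `X` of the columns with index in `M`. -/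
def columns {n p : ℕ} (X : Matrix (Fin n) (Fin p) ℝ) (M : Set (Fin p)) : Matrix (Fin n) M ℝ :=
  X.submatrix id Subtype.val

/-- Half the smallest modulus of a nonzero coefficient (`+∞` if there is none). -/
def halfMinSignal {p : ℕ} (β : Fin p → ℝ) : ℝ≥0∞ :=
  ⨅ j ∈ model β, ENNReal.ofReal (|β j| / 2)

/-! ### The linear model and the assumptions

For every sample size `n` there are a probability space `(Ω n, P n)`, random rows
`x n i : Ω n → ℝ^(p n)` of the design matrix and random errors `ε n i : Ω n → ℝ`, `i < n`. -/

section Model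

variable {Ω : ℕ → Type*} [∀ n, MeasurableSpace (Ω n)]

/-- The design matrix with rows `x n i`. -/
def design {p : ℕ → ℕ} (x : (n : ℕ) → Fin n → Ω n → Fin (p n) → ℝ) (n : ℕ) (ω : Ω n) :
    Matrix (Fin n) (Fin (p n)) ℝ :=
  Matrix.of fun i => x n i ω

/-- The response vector `y = X β + ε`. -/
def response {p : ℕ → ℕ} (x : (n : ℕ) → Fin n → Ω n → Fin (p n) → ℝ)
    (ε : (n : ℕ) → Fin n → Ω n → ℝ) (β : (n : ℕ) → Fin (p n) → ℝ) (n : ℕ) (ω : Ω n) :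
    Fin n → ℝ :=
  fun i => (design x n ω *ᵥ β n) i + ε n i ω

/-- The events `E n` hold with probability tending to one: the (outer) probability of the
complement tends to zero. -/
def WithProbTendingToOne (P : (n : ℕ) → Measure (Ω n)) (E : (n : ℕ) → Set (Ω n)) : Prop :=
  Tendsto (fun n => P n (E n)ᶜ) atTop (𝓝 0)

/-- The errors are i.i.d. with law `ν`, which has mean zero and finite variance `σ²`, and they are
independent of the design. -/
structure ErrorCondition {p : ℕ → ℕ} (P : (n : ℕ) → Measure (Ω n))
    (x : (n : ℕ) → Fin n → Ω n → Fin (p n) → ℝ) (ε : (n : ℕ) → Fin n → Ω n → ℝ)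
    (ν : Measure ℝ) (σ : ℝ) : Prop where
  measurable_design : ∀ n i, Measurable (x n i)
  measurable_error : ∀ n i, Measurable (ε n i)
  law_error : ∀ n i, (P n).map (ε n i) = ν
  indep_error : ∀ n, iIndepFun (ε n) (P n)
  square_integrable : MemLp (fun e : ℝ => e) 2 ν
  mean_zero : ∫ e, e ∂ν = 0
  variance_eq : variance (fun e : ℝ => e) ν = σ ^ 2
  indep_design : ∀ n, IndepFun (fun ω i => x n i ω) (fun ω i => ε n i ω) (P n)

/-- Bounded design: all entries of the design matrices are bounded by one constant. -/
def BoundedDesign {p : ℕ → ℕ} (P : (n : ℕ) → Measure (Ω n))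
    (x : (n : ℕ) → Fin n → Ω n → Fin (p n) → ℝ) : Prop :=
  ∃ L : ℝ, ∀ n i j, ∀ᵐ ω ∂(P n), |x n i ω j| ≤ L

/-- The error law satisfies `E exp((|ε| / a) ^ θ) ≤ b` for some finite `a, b > 0`. -/
def ErrorExpMoment (ν : Measure ℝ) (θ : ℝ) : Prop :=
  ∃ a b : ℝ, 0 < a ∧ 0 < b ∧
    ∫⁻ e, ENNReal.ofReal (Real.exp ((|e| / a) ^ θ)) ∂ν ≤ ENNReal.ofReal b

/-- Random design: i.i.d. rows, and `E exp((|X i j| / ρ) ^ α) ≤ L` for all entries. -/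
def RandomDesign {p : ℕ → ℕ} (P : (n : ℕ) → Measure (Ω n))
    (x : (n : ℕ) → Fin n → Ω n → Fin (p n) → ℝ) (α : ℝ) : Prop :=
  (∀ n, iIndepFun (x n) (P n)) ∧
  (∀ n i i', IdentDistrib (x n i) (x n i') (P n) (P n)) ∧
  ∃ ρ L : ℝ, 0 < ρ ∧ 0 < L ∧ ∀ n i j,
    ∫⁻ ω, ENNReal.ofReal (Real.exp ((|x n i ω j| / ρ) ^ α)) ∂(P n) ≤ ENNReal.ofReal L

/-- With `X₁` and `X₂` the submatrices of the relevant and of the irrelevant columns: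
`λ_min(n⁻¹ X₁ᵀ X₁) ≥ c₁` and `‖n⁻¹ X₂ᵀ X₁‖_{2,∞} ≤ c₂` with probability tending to one. -/
def DesignCondition {p : ℕ → ℕ} (P : (n : ℕ) → Measure (Ω n))
    (x : (n : ℕ) → Fin n → Ω n → Fin (p n) → ℝ) (β : (n : ℕ) → Fin (p n) → ℝ) : Prop :=
  open Classical in
  ∃ c₁ c₂ : ℝ, 0 < c₁ ∧ 0 < c₂ ∧
    WithProbTendingToOne P (fun n => {ω |
      (c₁ : EReal) ≤ lambdaMin ((n : ℝ)⁻¹ •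
        ((columns (design x n ω) (model (β n)))ᵀ * columns (design x n ω) (model (β n))))}) ∧
    WithProbTendingToOne P (fun n => {ω |
      normTwoInfty ((n : ℝ)⁻¹ •
        ((columns (design x n ω) (model (β n))ᶜ)ᵀ * columns (design x n ω) (model (β n))))
          ≤ ENNReal.ofReal c₂})

end Model

/-- Signal strength and tuning: `d_n ≥ n^(-γ) log n` for some `γ ∈ (0, 1/2]`, the level `lam n` is
of exact order `n^(-(1 - α₀)/2) log n`, and `lam n / d_n → 0`, where `d_n` is half the smallest
modulus of a nonzero coefficient. -/
def SignalTuningCondition {p : ℕ → ℕ} (β : (n : ℕ) → Fin (p n) → ℝ) (lam : ℕ → ℝ) (α₀ : ℝ) :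
    Prop :=
  (∃ γ : ℝ, 0 < γ ∧ γ ≤ 1 / 2 ∧ ∀ᶠ n : ℕ in atTop,
    ENNReal.ofReal ((n : ℝ) ^ (-γ) * Real.log n) ≤ halfMinSignal (β n)) ∧
  (∃ c C : ℝ, 0 < c ∧ 0 < C ∧ ∀ᶠ n : ℕ in atTop,
    c * ((n : ℝ) ^ (-((1 - α₀) / 2)) * Real.log n) ≤ lam n ∧
    lam n ≤ C * ((n : ℝ) ^ (-((1 - α₀) / 2)) * Real.log n)) ∧
  (∀ K : ℝ, 0 < K → ∀ᶠ n : ℕ in atTop, ENNReal.ofReal (K * lam n) ≤ halfMinSignal (β n))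

end SCAD

end

/-! The witness is the oracle estimator: least squares on the relevant columns, zero elsewhere. The
SCAD penalty is flat beyond `a * lam` and linear with slope `lam` near zero. So if the oracle
coefficients on the support exceed `a * lam`, the penalty is locally constant there and the normal
equations remove the linear terms. If each irrelevant column has inner product less than `n * lam`
with the residual, moving off zero costs more than it gains. Hence the oracle is a strict local
minimizer (`isStrictLocalMin_objective`).

Let `H` be the projection onto the relevant columns and `s` their number. `oracle_isStrictLocalMin`
reduces both requirements to two bounds on the noise `e`, given the design condition and the signal
strength. The first is that `eᵀ H e` is at most a small multiple of `n * lam ^ 2`, which is at least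
of order `n ^ α₀ * (log n) ^ 2`. Its conditional mean is at most `σ ^ 2 * s`, and its conditional
variance is `O(s)` by the second moment bound for centred quadratic forms
(`integral_centredForm_sq_le`), so Chebyshev leaves a spare logarithm. The second is that all inner
products of columns with `e` are at most `n * lam / 2`. The tail assumptions give these sums a
sub-Gaussian moment generating function near zero, and Chernoff with a union bound over the `p`
columns absorbs `log p = O(n ^ α₀)` (`tendsto_union_bound`).

On the good event the residual sum of squares is `∑ e i ^ 2 - eᵀ H e`. The normalized variance error
then differs from the normalized sum of `e i ^ 2 - σ ^ 2` by a centred quadratic form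
(`oracle_error_sub_eq`). Dividing by `n - s` makes the trace of its matrix vanish, and its squared
Frobenius norm is of order `s / n`. Therefore `s = o(n)` suffices, with no need for `s = o(√n)`, and
the central limit theorem for the squared errors finishes by Slutsky. -/

namespace SCAD

/-! ### The SCAD penalty -/

lemma penaltyDeriv_eq {a lam : ℝ} (ha : 1 < a) (hl : 0 < lam) (t : ℝ) :
    penaltyDeriv a lam t = min lam (max (a * lam - t) 0 / (a - 1)) := by
  have ha' : 0 < a - 1 := by linarith
  unfold penaltyDeriv
  rcases le_or_gt t lam with h | h
  · have : lam ≤ max (a * lam - t) 0 / (a - 1) := by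
      rw [le_div_iff₀ ha']
      exact le_trans (by nlinarith) (le_max_left _ _)
    rw [min_eq_left this]
    simp [h, not_lt.2 h]
  · have : max (a * lam - t) 0 / (a - 1) ≤ lam := by
      rw [div_le_iff₀ ha']
      exact max_le (by nlinarith) (by positivity)
    rw [min_eq_right this]
    simp only [h, not_le.2 h, if_true, if_false]
    field_simp
    ring

lemma continuous_penaltyDeriv {a lam : ℝ} (ha : 1 < a) (hl : 0 < lam) :
    Continuous (penaltyDeriv a lam) := by
  rw [show penaltyDeriv a lam = fun t => min lam (max (a * lam - t) 0 / (a - 1)) from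
    funext fun t => penaltyDeriv_eq ha hl t]
  fun_prop

lemma penalty_eq_linear {a lam t : ℝ} (ht : 0 ≤ t) (htl : t ≤ lam) :
    penalty a lam t = lam * t := by
  unfold penalty
  rw [intervalIntegral.integral_congr (g := fun _ => lam)]
  · simp [mul_comm]
  · intro u hu
    rw [Set.uIcc_of_le ht] at hu
    have : u ≤ lam := hu.2.trans htl
    simp [penaltyDeriv, this, not_lt.2 this]

lemma penalty_eq_const {a lam t : ℝ} (ha : 1 < a) (hl : 0 < lam) (ht : a * lam ≤ t) :
    penalty a lam t = penalty a lam (a * lam) := by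
  have hc := continuous_penaltyDeriv ha hl
  unfold penalty
  rw [← intervalIntegral.integral_add_adjacent_intervals (hc.intervalIntegrable 0 (a * lam))
    (hc.intervalIntegrable (a * lam) t)]
  rw [intervalIntegral.integral_congr (a := a * lam) (b := t) (g := fun _ => (0 : ℝ))]
  · simp
  · intro u hu
    rw [Set.uIcc_of_le ht] at hu
    have h0 : 0 ≤ a - 1 := by linarith
    simp [penaltyDeriv_eq ha hl, max_eq_right (sub_nonpos.2 hu.1), hl.le]

/-! ### A sufficient condition for a strict local minimizer -/

/-- The least squares part is quadratic, so its expansion at `b` is exact. The linear term is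
grouped with the penalty coordinate by coordinate, so that signs can be decided one coordinate at a
time. -/
lemma objective_sub {n p : ℕ} (a lam : ℝ) (X : Matrix (Fin n) (Fin p) ℝ) (y : Fin n → ℝ)
    (b b' : Fin p → ℝ) :
    objective a lam X y b' - objective a lam X y b =
      ∑ i, ((X *ᵥ (b' - b)) i) ^ 2 +
      ∑ j, (2 * n * (penalty a lam |b' j| - penalty a lam |b j|) -
        2 * ((b' j - b j) * ∑ i, X i j * (y i - (X *ᵥ b) i))) := by
  have h1 : ∑ j, (b' j - b j) * ∑ i, X i j * (y i - (X *ᵥ b) i) =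
      ∑ i, (X *ᵥ (b' - b)) i * (y i - (X *ᵥ b) i) := by
    simp only [Matrix.mulVec, dotProduct, Finset.mul_sum, Finset.sum_mul, Pi.sub_apply]
    rw [Finset.sum_comm]
    exact Finset.sum_congr rfl fun i _ => Finset.sum_congr rfl fun j _ => by ring
  rw [Finset.sum_sub_distrib, ← Finset.mul_sum, ← Finset.mul_sum, h1, Finset.sum_sub_distrib]
  unfold objective
  rw [Matrix.mulVec_sub]
  simp only [Pi.sub_apply]
  have : ∑ i, (y i - (X *ᵥ b') i) ^ 2 = ∑ i, (y i - (X *ᵥ b) i) ^ 2 +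
      ∑ i, ((X *ᵥ b') i - (X *ᵥ b) i) ^ 2 -
      2 * ∑ i, ((X *ᵥ b') i - (X *ᵥ b) i) * (y i - (X *ᵥ b) i) := by
    rw [Finset.mul_sum, ← Finset.sum_add_distrib, ← Finset.sum_sub_distrib]
    exact Finset.sum_congr rfl fun i _ => by ring
  rw [this]
  ring

/-- Near `b` the nonconvex part of the penalty is never met: coordinates in `M` stay in the flat
region and the others in the linear one. The concavity in between plays no role. -/
lemma isStrictLocalMin_objective {n p : ℕ} {a lam : ℝ} (ha : 1 < a) (hl : 0 < lam)
    (X : Matrix (Fin n) (Fin p) ℝ) (y : Fin n → ℝ) (M : Set (Fin p)) (b : Fin p → ℝ)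
    (horth : ∀ j ∈ M, ∑ i, X i j * (y i - (X *ᵥ b) i) = 0)
    (hres : ∀ j ∉ M, |∑ i, X i j * (y i - (X *ᵥ b) i)| < n * lam)
    (hlarge : ∀ j ∈ M, a * lam < |b j|) (hzero : ∀ j ∉ M, b j = 0)
    (hinj : ∀ v : Fin p → ℝ, (∀ j ∉ M, v j = 0) → X *ᵥ v = 0 → v = 0) :
    IsStrictLocalMin (objective a lam X y) b := by
  have h1 : ∀ᶠ b' in 𝓝 b, ∀ j, (j ∈ M → a * lam < |b' j|) ∧ (j ∉ M → |b' j| < lam) := by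
    refine eventually_all.2 fun j => ?_
    have hc : Tendsto (fun b' : Fin p → ℝ => |b' j|) (𝓝 b) (𝓝 |b j|) :=
      ((continuous_apply j).abs).tendsto b
    by_cases hj : j ∈ M
    · filter_upwards [hc.eventually_const_lt (hlarge j hj)] with b' h
      exact ⟨fun _ => h, fun h' => absurd hj h'⟩
    · have h0 : |b j| < lam := by simpa [hzero j hj] using hl
      filter_upwards [hc.eventually_lt_const h0] with b' h
      exact ⟨fun h' => absurd h' hj, fun _ => h⟩
  unfold IsStrictLocalMin
  filter_upwards [nhdsWithin_le_nhds h1, self_mem_nhdsWithin] with b' hb' hne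
  have hne : b' ≠ b := hne
  rw [← sub_pos, objective_sub]
  have hterm : ∀ j, (j ∈ M → 2 * n * (penalty a lam |b' j| - penalty a lam |b j|) -
        2 * ((b' j - b j) * ∑ i, X i j * (y i - (X *ᵥ b) i)) = 0) ∧
      (j ∉ M → 2 * (n * lam - |∑ i, X i j * (y i - (X *ᵥ b) i)|) * |b' j| ≤
        2 * n * (penalty a lam |b' j| - penalty a lam |b j|) -
        2 * ((b' j - b j) * ∑ i, X i j * (y i - (X *ᵥ b) i))) := by
    intro j
    refine ⟨fun hj => ?_, fun hj => ?_⟩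
    · rw [horth j hj, penalty_eq_const ha hl ((hb' j).1 hj).le,
        penalty_eq_const ha hl (hlarge j hj).le]
      ring
    · rw [hzero j hj, penalty_eq_linear (abs_nonneg _) ((hb' j).2 hj).le,
        penalty_eq_linear (abs_nonneg _) (by simpa using hl.le)]
      have := le_abs_self (b' j * ∑ i, X i j * (y i - (X *ᵥ b) i))
      rw [abs_mul] at this
      simp only [abs_zero, sub_zero, mul_zero]
      nlinarith
  have hnn : ∀ j, 0 ≤ 2 * n * (penalty a lam |b' j| - penalty a lam |b j|) -
        2 * ((b' j - b j) * ∑ i, X i j * (y i - (X *ᵥ b) i)) := by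
    intro j
    by_cases hj : j ∈ M
    · exact ((hterm j).1 hj).ge
    · refine le_trans ?_ ((hterm j).2 hj)
      have := hres j hj
      exact mul_nonneg (by linarith) (abs_nonneg _)
  -- Strictness has two sources: the quadratic term, by injectivity, if the perturbation lives on
  -- `M`; otherwise the slope gap `n * lam - |…|` of a coordinate outside `M`.
  by_cases hM : ∀ j ∉ M, b' j = 0
  · have hv : X *ᵥ (b' - b) ≠ 0 := fun h0 => hne <| sub_eq_zero.1 <|
      hinj (b' - b) (fun j hj => by simp [hM j hj, hzero j hj]) h0
    obtain ⟨i, hi⟩ := Function.ne_iff.1 hv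
    refine add_pos_of_pos_of_nonneg ?_ (Finset.sum_nonneg fun j _ => hnn j)
    exact Finset.sum_pos' (fun i _ => sq_nonneg _) ⟨i, Finset.mem_univ _, sq_pos_of_ne_zero hi⟩
  · push Not at hM
    obtain ⟨j, hj, hbj⟩ := hM
    refine add_pos_of_nonneg_of_pos (Finset.sum_nonneg fun i _ => sq_nonneg _) ?_
    refine Finset.sum_pos' (fun j _ => hnn j) ⟨j, Finset.mem_univ _, ?_⟩
    refine lt_of_lt_of_le ?_ ((hterm j).2 hj)
    have := hres j hj
    exact mul_pos (by linarith) (abs_pos.2 hbj)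

/-! ### Gram matrices, projections and least squares -/

section LinearAlgebra

variable {m ι κ : Type*} [Fintype m] [Fintype ι] [Fintype κ]

/-- Subtracting `c` times the identity shifts the spectrum by `c`, so the shifted Gram matrix is
positive semidefinite. -/
lemma sum_sq_mulVec_ge_of_le_lambdaMin [DecidableEq ι] {A : Matrix m ι ℝ} {c N : ℝ} (hN : 0 < N)
    (h : (c : EReal) ≤ lambdaMin (N⁻¹ • (Aᵀ * A))) (v : ι → ℝ) :
    c * N * ∑ k, v k ^ 2 ≤ ∑ i, (A *ᵥ v) i ^ 2 := by
  have hH : (N⁻¹ • (Aᵀ * A)).IsHermitian := by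
    ext i j
    simp [Matrix.mul_apply, mul_comm]
  have hps : (N⁻¹ • (Aᵀ * A) - algebraMap ℝ (Matrix ι ι ℝ) c).PosSemidef := by
    rw [Matrix.posSemidef_iff_isHermitian_and_spectrum_nonneg]
    refine ⟨hH.sub (by ext i j; by_cases hij : i = j <;>
      simp [Matrix.algebraMap_matrix_apply, hij, eq_comm]), ?_⟩
    intro μ hμ
    have hμ' : μ + c ∈ spectrum ℝ (N⁻¹ • (Aᵀ * A)) := by
      have := spectrum.add_mem_add_iff (R := ℝ) (A := Matrix ι ι ℝ) (r := μ) (s := c)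
        (a := N⁻¹ • (Aᵀ * A) - algebraMap ℝ (Matrix ι ι ℝ) c)
      have h2 := this.2 hμ
      rwa [add_sub_cancel] at h2
    have h3 : (c : EReal) ≤ ((μ + c : ℝ) : EReal) := h.trans (iInf₂_le _ hμ')
    have h4 : c ≤ μ + c := by exact_mod_cast h3
    simpa using h4
  have h5 := hps.dotProduct_mulVec_nonneg v
  have h6 : v ⬝ᵥ ((Aᵀ * A) *ᵥ v) = ∑ i, (A *ᵥ v) i ^ 2 := by
    rw [← Matrix.mulVec_mulVec, Matrix.dotProduct_mulVec, Matrix.vecMul_transpose]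
    simp [dotProduct, sq]
  have h7 : v ⬝ᵥ (algebraMap ℝ (Matrix ι ι ℝ) c *ᵥ v) = c * ∑ k, v k ^ 2 := by
    rw [Algebra.algebraMap_eq_smul_one, Matrix.smul_mulVec, Matrix.one_mulVec, dotProduct_smul]
    simp [dotProduct, sq]
  rw [star_trivial, Matrix.sub_mulVec, dotProduct_sub, Matrix.smul_mulVec, dotProduct_smul, h6, h7,
    smul_eq_mul, sub_nonneg, le_inv_mul_iff₀ hN] at h5
  linarith

lemma abs_mulVec_le_of_normTwoInfty_le {B : Matrix κ ι ℝ} {c : ℝ} (hc : 0 ≤ c)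
    (h : normTwoInfty B ≤ ENNReal.ofReal c) (v : ι → ℝ) (k : κ) :
    |(B *ᵥ v) k| ≤ c * √(∑ l, v l ^ 2) := by
  have hnorm : ‖WithLp.toLp 2 v‖ = √(∑ l, v l ^ 2) := by
    simp [EuclideanSpace.norm_eq]
  rw [← hnorm]
  rcases eq_or_ne v 0 with rfl | hv
  · simp
  have hpos : 0 < ‖WithLp.toLp 2 v‖ := norm_pos_iff.2 (by simpa using hv)
  set r := ‖WithLp.toLp 2 v‖ with hr
  have h1 : ‖B *ᵥ (r⁻¹ • WithLp.toLp 2 v).ofLp‖ₑ ≤ ENNReal.ofReal c := by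
    refine le_trans (le_iSup₂_of_le (r⁻¹ • WithLp.toLp 2 v) ?_ le_rfl) h
    rw [norm_smul, ← hr, norm_inv, Real.norm_of_nonneg hpos.le, inv_mul_cancel₀ hpos.ne']
  have h2 : ‖B *ᵥ (r⁻¹ • v)‖ ≤ c := by
    rw [← ofReal_norm, ENNReal.ofReal_le_ofReal_iff hc] at h1
    simpa using h1
  have h3 := (norm_le_pi_norm (B *ᵥ (r⁻¹ • v)) k).trans h2
  rw [Matrix.mulVec_smul, Pi.smul_apply, smul_eq_mul, norm_mul, norm_inv,
    Real.norm_of_nonneg hpos.le, Real.norm_eq_abs, inv_mul_le_iff₀ hpos] at h3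
  linarith

variable [DecidableEq ι]

/-- The projection matrix `A (Aᵀ A)⁻¹ Aᵀ` (zero if `Aᵀ A` is singular). -/
noncomputable def hatMatrix (A : Matrix m ι ℝ) : Matrix m m ℝ := A * (Aᵀ * A)⁻¹ * Aᵀ

lemma hatMatrix_transpose (A : Matrix m ι ℝ) : (hatMatrix A)ᵀ = hatMatrix A := by
  simp [hatMatrix, Matrix.transpose_mul, Matrix.transpose_nonsing_inv, Matrix.mul_assoc]

/-- Invertibility is not needed because a singular matrix has inverse `0` by convention. The
Frobenius bounds thus hold for every design, with no exceptional event to remove when integrating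
over it. -/
lemma hatMatrix_mul_self (A : Matrix m ι ℝ) : hatMatrix A * hatMatrix A = hatMatrix A := by
  have h : (Aᵀ * A)⁻¹ * (Aᵀ * A) * (Aᵀ * A)⁻¹ = (Aᵀ * A)⁻¹ := by
    by_cases hu : IsUnit (Aᵀ * A).det
    · rw [Matrix.nonsing_inv_mul _ hu, Matrix.one_mul]
    · simp [Matrix.nonsing_inv_apply_not_isUnit _ hu]
  calc hatMatrix A * hatMatrix A = A * ((Aᵀ * A)⁻¹ * (Aᵀ * A) * (Aᵀ * A)⁻¹) * Aᵀ := by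
        simp only [hatMatrix, Matrix.mul_assoc]
    _ = _ := by rw [h]; rfl

lemma trace_hatMatrix {A : Matrix m ι ℝ} (hu : IsUnit (Aᵀ * A).det) :
    (hatMatrix A).trace = Fintype.card ι := by
  rw [hatMatrix, Matrix.trace_mul_comm, ← Matrix.mul_assoc, Matrix.mul_nonsing_inv _ hu,
    Matrix.trace_one]

lemma trace_hatMatrix_le (A : Matrix m ι ℝ) : (hatMatrix A).trace ≤ Fintype.card ι := by
  by_cases hu : IsUnit (Aᵀ * A).det
  · exact (trace_hatMatrix hu).le
  · simp [hatMatrix, Matrix.nonsing_inv_apply_not_isUnit _ hu]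

/-- For a symmetric idempotent, `tr (Hᵀ H) = tr H`. The squared Frobenius norm is therefore at most
the model size, which controls all variances below. -/
lemma sum_sq_hatMatrix (A : Matrix m ι ℝ) :
    ∑ i, ∑ j, hatMatrix A i j ^ 2 = (hatMatrix A).trace := by
  conv_rhs => rw [← hatMatrix_mul_self]
  simp only [Matrix.trace, Matrix.diag_apply, Matrix.mul_apply]
  refine Finset.sum_congr rfl fun i _ => Finset.sum_congr rfl fun j _ => ?_
  have : hatMatrix A j i = hatMatrix A i j := by
    conv_lhs => rw [← hatMatrix_transpose]
    rfl
  rw [this, sq]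

lemma isUnit_det_gram {A : Matrix m ι ℝ} (h : ∀ v, A *ᵥ v = 0 → v = 0) :
    IsUnit (Aᵀ * A).det := by
  rw [← Matrix.isUnit_iff_isUnit_det, ← Matrix.mulVec_injective_iff_isUnit]
  intro v w hvw
  rw [← sub_eq_zero]
  apply h
  have h1 : (Aᵀ * A) *ᵥ (v - w) = 0 := by rw [Matrix.mulVec_sub]; exact sub_eq_zero.2 hvw
  have h2 : (v - w) ⬝ᵥ ((Aᵀ * A) *ᵥ (v - w)) = 0 := by rw [h1, dotProduct_zero]
  rw [← Matrix.mulVec_mulVec, Matrix.dotProduct_mulVec, Matrix.vecMul_transpose] at h2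
  exact dotProduct_self_eq_zero.1 h2

/-- The vector of least squares coefficients. -/
noncomputable def leastSquares (A : Matrix m ι ℝ) (e : m → ℝ) : ι → ℝ := (Aᵀ * A)⁻¹ *ᵥ (Aᵀ *ᵥ e)

lemma mulVec_leastSquares (A : Matrix m ι ℝ) (e : m → ℝ) :
    A *ᵥ leastSquares A e = hatMatrix A *ᵥ e := by
  simp [leastSquares, hatMatrix, Matrix.mulVec_mulVec, Matrix.mul_assoc]

lemma leastSquares_add (A : Matrix m ι ℝ) (hu : IsUnit (Aᵀ * A).det) (b : ι → ℝ) (e : m → ℝ) :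
    leastSquares A (A *ᵥ b + e) = b + leastSquares A e := by
  unfold leastSquares
  rw [Matrix.mulVec_add, Matrix.mulVec_add, Matrix.mulVec_mulVec b Aᵀ A, Matrix.mulVec_mulVec b,
    Matrix.nonsing_inv_mul _ hu, Matrix.one_mulVec]

lemma transpose_mulVec_residual {A : Matrix m ι ℝ} (hu : IsUnit (Aᵀ * A).det) (e : m → ℝ) :
    Aᵀ *ᵥ (e - A *ᵥ leastSquares A e) = 0 := by
  rw [Matrix.mulVec_sub, leastSquares, Matrix.mulVec_mulVec _ Aᵀ A, Matrix.mulVec_mulVec _ (Aᵀ * A),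
    Matrix.mul_nonsing_inv _ hu, Matrix.one_mulVec, sub_self]

lemma sum_sq_hatMatrix_mulVec (A : Matrix m ι ℝ) (e : m → ℝ) :
    ∑ i, (hatMatrix A *ᵥ e) i ^ 2 = e ⬝ᵥ (hatMatrix A *ᵥ e) := by
  conv_rhs => rw [← hatMatrix_mul_self, ← Matrix.mulVec_mulVec, Matrix.dotProduct_mulVec,
    ← hatMatrix_transpose, Matrix.vecMul_transpose, hatMatrix_transpose]
  simp [dotProduct, sq]

lemma sum_sq_residual (A : Matrix m ι ℝ) (e : m → ℝ) :
    ∑ i, (e i - (A *ᵥ leastSquares A e) i) ^ 2 = ∑ i, e i ^ 2 - e ⬝ᵥ (hatMatrix A *ᵥ e) := by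
  have h : ∑ i, (e i - (A *ᵥ leastSquares A e) i) ^ 2 = ∑ i, e i ^ 2 -
      2 * (e ⬝ᵥ (hatMatrix A *ᵥ e)) + ∑ i, (hatMatrix A *ᵥ e) i ^ 2 := by
    rw [mulVec_leastSquares, dotProduct, Finset.mul_sum, ← Finset.sum_sub_distrib,
      ← Finset.sum_add_distrib]
    exact Finset.sum_congr rfl fun i _ => by ring
  rw [h, sum_sq_hatMatrix_mulVec]
  ring

end LinearAlgebra

/-! ### The oracle estimator and its deterministic optimality -/

open Classical in
/-- The oracle estimator: least squares on the columns in `M`, and zero elsewhere. -/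
noncomputable def oracleEstimator {n p : ℕ} (M : Set (Fin p))
    (z : (Fin n → Fin p → ℝ) × (Fin n → ℝ)) : Fin p → ℝ :=
  fun j => if h : j ∈ M then leastSquares (columns (Matrix.of z.1) M) z.2 ⟨j, h⟩ else 0

lemma oracleEstimator_of_notMem {n p : ℕ} {M : Set (Fin p)}
    (z : (Fin n → Fin p → ℝ) × (Fin n → ℝ)) {j : Fin p} (hj : j ∉ M) :
    oracleEstimator M z j = 0 := by
  simp [oracleEstimator, hj]

lemma mulVec_eq_columns_mulVec {n p : ℕ} (X : Matrix (Fin n) (Fin p) ℝ) (M : Set (Fin p))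
    [Fintype M] {w : Fin p → ℝ} (hw : ∀ j ∉ M, w j = 0) :
    X *ᵥ w = columns X M *ᵥ fun k => w k := by
  classical
  ext i
  simp only [Matrix.mulVec, dotProduct, columns, Matrix.submatrix_apply, id]
  rw [← Finset.sum_subtype (Finset.univ.filter (· ∈ M)) (by simp) fun j => X i j * w j]
  rw [Finset.sum_filter_of_ne]
  intro j _ hj
  by_contra h
  simp [hw j h] at hj

-- Least squares reproduces the signal exactly, so both the coefficient error and the residual
-- depend on the noise alone.
open Classical in
lemma response_sub_oracle {n p : ℕ} (X : Matrix (Fin n) (Fin p) ℝ) (β : Fin p → ℝ)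
    (e : Fin n → ℝ) (hu : IsUnit ((columns X (model β))ᵀ * columns X (model β)).det) :
    (∀ k : model β, oracleEstimator (model β) (X, X *ᵥ β + e) k =
      β k + leastSquares (columns X (model β)) e k) ∧
    (X *ᵥ β + e) - X *ᵥ oracleEstimator (model β) (X, X *ᵥ β + e) =
      e - columns X (model β) *ᵥ leastSquares (columns X (model β)) e := by
  have h0 : X *ᵥ β = columns X (model β) *ᵥ fun k => β k :=
    mulVec_eq_columns_mulVec X (model β) (by simp [model])
  have h1 : ∀ k : model β, oracleEstimator (model β) (X, X *ᵥ β + e) k =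
      β k + leastSquares (columns X (model β)) e k := by
    intro k
    have h2 := congrFun (leastSquares_add (columns X (model β)) hu (fun k => β k) e) k
    rw [← h0] at h2
    simp only [oracleEstimator, Subtype.coe_prop, dif_pos]
    exact h2
  refine ⟨h1, ?_⟩
  rw [mulVec_eq_columns_mulVec X (model β) (w := oracleEstimator (model β) (X, X *ᵥ β + e))
    (fun j hj => oracleEstimator_of_notMem _ hj), h0]
  have h3 : (fun k : model β => oracleEstimator (model β) (X, X *ᵥ β + e) k) =
      (fun k : model β => β k) + leastSquares (columns X (model β)) e := funext h1
  rw [← h0, h3, Matrix.mulVec_add, ← h0]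
  abel

open Classical in
lemma isUnit_det_of_le_lambdaMin {n p : ℕ} (hn : 0 < n) {c : ℝ} (hc : 0 < c)
    {X : Matrix (Fin n) (Fin p) ℝ} {M : Set (Fin p)}
    (h : (c : EReal) ≤ lambdaMin ((n : ℝ)⁻¹ • ((columns X M)ᵀ * columns X M))) :
    IsUnit ((columns X M)ᵀ * columns X M).det := by
  refine isUnit_det_gram fun v hv => ?_
  have hn' : (0 : ℝ) < n := by exact_mod_cast hn
  have h1 := sum_sq_mulVec_ge_of_le_lambdaMin hn' h v
  simp only [hv, Pi.zero_apply, ne_eq, OfNat.ofNat_ne_zero, not_false_eq_true, zero_pow,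
    Finset.sum_const_zero] at h1
  have h2 : ∑ k, v k ^ 2 ≤ 0 := by
    by_contra h3
    have : 0 < c * n * ∑ k, v k ^ 2 := mul_pos (by positivity) (not_le.1 h3)
    linarith
  have h3 := (Finset.sum_eq_zero_iff_of_nonneg fun k _ => sq_nonneg (v k)).1
    (le_antisymm h2 (Finset.sum_nonneg fun k _ => sq_nonneg _))
  ext k
  simpa using h3 k (Finset.mem_univ k)

-- The eigenvalue bound turns `eᵀ H e` into a bound on the coefficient error `v`: by `lam` from
-- `hq₁`, and by `lam / (4 * c₂)` from `hq₂`.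
open Classical in
lemma oracle_isStrictLocalMin {n p : ℕ} (hn : 0 < n) {a lam c₁ c₂ : ℝ} (ha : 1 < a)
    (hl : 0 < lam) (hc₁ : 0 < c₁) (hc₂ : 0 < c₂)
    (X : Matrix (Fin n) (Fin p) ℝ) (β : Fin p → ℝ) (e : Fin n → ℝ)
    (hmin : (c₁ : EReal) ≤ lambdaMin
      ((n : ℝ)⁻¹ • ((columns X (model β))ᵀ * columns X (model β))))
    (hnorm : normTwoInfty ((n : ℝ)⁻¹ • ((columns X (model β)ᶜ)ᵀ * columns X (model β)))
      ≤ ENNReal.ofReal c₂)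
    (hq₁ : e ⬝ᵥ (hatMatrix (columns X (model β)) *ᵥ e) ≤ c₁ * n * lam ^ 2)
    (hq₂ : e ⬝ᵥ (hatMatrix (columns X (model β)) *ᵥ e) ≤ c₁ * n * (lam / (4 * c₂)) ^ 2)
    (hT : ∀ j, |∑ i, X i j * e i| ≤ n * lam / 2)
    (hβ : ∀ j ∈ model β, a * lam ≤ |β j| / 2) :
    IsStrictLocalMin (objective a lam X (X *ᵥ β + e))
      (oracleEstimator (model β) (X, X *ᵥ β + e)) ∧
    model (oracleEstimator (model β) (X, X *ᵥ β + e)) = model β := by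
  have hn' : (0 : ℝ) < n := by exact_mod_cast hn
  have hu := isUnit_det_of_le_lambdaMin hn hc₁ hmin
  obtain ⟨hb, hr⟩ := response_sub_oracle X β e hu
  set b := oracleEstimator (model β) (X, X *ᵥ β + e) with hbdef
  set A := columns X (model β) with hA
  set v := leastSquares A e with hv
  have hv1 : c₁ * n * ∑ k, v k ^ 2 ≤ e ⬝ᵥ (hatMatrix A *ᵥ e) := by
    have := sum_sq_mulVec_ge_of_le_lambdaMin hn' hmin v
    rwa [hv, mulVec_leastSquares, sum_sq_hatMatrix_mulVec] at this
  have hs1 : √(∑ k, v k ^ 2) ≤ lam := by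
    rw [Real.sqrt_le_left hl.le]
    exact le_of_mul_le_mul_left (hv1.trans hq₁) (by positivity)
  have hs2 : √(∑ k, v k ^ 2) ≤ lam / (4 * c₂) := by
    rw [Real.sqrt_le_left (by positivity)]
    exact le_of_mul_le_mul_left (hv1.trans hq₂) (by positivity)
  have hvk : ∀ k, |v k| ≤ lam := fun k => by
    refine le_trans (Real.le_sqrt_of_sq_le ?_) hs1
    rw [sq_abs]
    exact Finset.single_le_sum (f := fun k => v k ^ 2) (fun k _ => sq_nonneg _) (Finset.mem_univ k)
  have hlarge : ∀ j ∈ model β, a * lam < |b j| := by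
    intro j hj
    have h1 := hβ j hj
    have h2 := hvk ⟨j, hj⟩
    have h3 : b j = β j + v ⟨j, hj⟩ := hb ⟨j, hj⟩
    have h4 : |β j| ≤ |b j| + |v ⟨j, hj⟩| := by
      have : β j = b j - v ⟨j, hj⟩ := by rw [h3]; ring
      rw [this]
      exact abs_sub _ _
    -- The true coefficient is at least `2 * a * lam` and the error at most `lam`, which is below `a
    -- * lam` since `1 < a`.
    nlinarith
  have hri : ∀ i, (X *ᵥ β + e) i - (X *ᵥ b) i = e i - (A *ᵥ v) i := fun i => congrFun hr i
  refine ⟨isStrictLocalMin_objective ha hl X _ (model β) b ?_ ?_ hlarge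
    (fun j hj => oracleEstimator_of_notMem _ hj) ?_, ?_⟩
  · intro j hj
    have := congrFun (transpose_mulVec_residual hu e) ⟨j, hj⟩
    simp only [hri]
    exact this
  · intro j hj
    have h1 : ∑ i, X i j * (e i - (A *ᵥ v) i) = ∑ i, X i j * e i - ∑ i, X i j * (A *ᵥ v) i := by
      rw [← Finset.sum_sub_distrib]
      exact Finset.sum_congr rfl fun i _ => by ring
    have h2 := abs_mulVec_le_of_normTwoInfty_le hc₂.le hnorm v ⟨j, hj⟩
    have h3 : (((n : ℝ)⁻¹ • ((columns X (model β)ᶜ)ᵀ * A)) *ᵥ v) ⟨j, hj⟩ =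
        (n : ℝ)⁻¹ * ∑ i, X i j * (A *ᵥ v) i := by
      rw [Matrix.smul_mulVec, ← Matrix.mulVec_mulVec]
      rfl
    rw [h3, abs_mul, abs_inv, abs_of_pos hn', inv_mul_le_iff₀ hn'] at h2
    have h4 : c₂ * √(∑ k, v k ^ 2) ≤ lam / 4 := by
      calc c₂ * √(∑ k, v k ^ 2) ≤ c₂ * (lam / (4 * c₂)) := by gcongr
        _ = lam / 4 := by field_simp
    have h5 : (n : ℝ) * (c₂ * √(∑ k, v k ^ 2)) ≤ n * (lam / 4) := by gcongr
    simp only [hri]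
    rw [h1]
    have h6 := abs_sub (∑ i, X i j * e i) (∑ i, X i j * (A *ᵥ v) i)
    have h7 := hT j
    have h8 : 0 < n * lam := by positivity
    linarith
  · intro w hw hXw
    rw [mulVec_eq_columns_mulVec X (model β) hw] at hXw
    have h1 := sum_sq_mulVec_ge_of_le_lambdaMin hn' hmin fun k => w k
    have h2 : (fun k : model β => w k) = 0 := by
      have h3 : (Aᵀ * A) *ᵥ (fun k : model β => w k) = 0 := by
        rw [← Matrix.mulVec_mulVec, hXw, Matrix.mulVec_zero]
      have h4 := congrArg (fun u => (Aᵀ * A)⁻¹ *ᵥ u) h3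
      simpa [Matrix.mulVec_mulVec, Matrix.nonsing_inv_mul _ hu] using h4
    ext j
    by_cases hj : j ∈ model β
    · exact congrFun h2 ⟨j, hj⟩
    · exact hw j hj
  · ext j
    by_cases hj : j ∈ model β
    · have : b j ≠ 0 := abs_pos.1 (lt_trans (by positivity) (hlarge j hj))
      exact ⟨fun _ => hj, fun _ => this⟩
    · have : b j = 0 := oracleEstimator_of_notMem _ hj
      exact ⟨fun h => absurd this h, fun h => absurd h hj⟩

open Classical in
lemma plugInVariance_oracle {n p : ℕ} (X : Matrix (Fin n) (Fin p) ℝ) (β : Fin p → ℝ)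
    (e : Fin n → ℝ) (hu : IsUnit ((columns X (model β))ᵀ * columns X (model β)).det)
    (hmodel : model (oracleEstimator (model β) (X, X *ᵥ β + e)) = model β) :
    plugInVariance X (X *ᵥ β + e) (oracleEstimator (model β) (X, X *ᵥ β + e)) =
      (∑ i, e i ^ 2 - e ⬝ᵥ (hatMatrix (columns X (model β)) *ᵥ e)) /
        (n - (model β).ncard) := by
  unfold plugInVariance
  rw [hmodel, ← sum_sq_residual]
  congr 1
  refine Finset.sum_congr rfl fun i _ => ?_
  congr 1
  exact congrFun (response_sub_oracle X β e hu).2 i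

/-! ### Measurability of the estimator -/

section Measurability

variable {E : Type*} [MeasurableSpace E]

/-- Cramer's rule: a polynomial in the entries times the inverse determinant. Real inversion is
measurable also at `0`, so singular matrices need no separate treatment. -/
lemma measurable_inv_entry {ι : Type*} [Fintype ι] [DecidableEq ι] {G : E → Matrix ι ι ℝ}
    (hG : ∀ k l, Measurable fun z => G z k l) (k l : ι) : Measurable fun z => (G z)⁻¹ k l := by
  have hm : Measurable fun z => fun q : ι × ι => G z q.1 q.2 :=
    measurable_pi_lambda _ fun q => hG q.1 q.2
  have hof : Continuous fun w : ι × ι → ℝ => (Matrix.of fun i j => w (i, j) : Matrix ι ι ℝ) :=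
    continuous_pi fun i => continuous_pi fun j => continuous_apply (i, j)
  have h1 : Measurable fun w : ι × ι → ℝ =>
      Ring.inverse (Matrix.of fun i j => w (i, j) : Matrix ι ι ℝ).det *
        (Matrix.of fun i j => w (i, j) : Matrix ι ι ℝ).adjugate k l := by
    simp only [Ring.inverse_eq_inv']
    refine (hof.matrix_det.measurable.inv).mul ?_
    exact ((continuous_apply l).comp ((continuous_apply k).comp hof.matrix_adjugate)).measurable
  have h2 := h1.comp hm
  have h3 : (fun z => (G z)⁻¹ k l) = (fun w : ι × ι → ℝ =>
      Ring.inverse (Matrix.of fun i j => w (i, j) : Matrix ι ι ℝ).det *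
        (Matrix.of fun i j => w (i, j) : Matrix ι ι ℝ).adjugate k l) ∘
      (fun z => fun q : ι × ι => G z q.1 q.2) := by
    ext z
    rw [Matrix.inv_def]
    rfl
  rw [h3]
  exact h2

lemma measurable_mul_entry {ι κ m : Type*} [Fintype κ] {A : E → Matrix ι κ ℝ}
    {B : E → Matrix κ m ℝ} (hA : ∀ i k, Measurable fun z => A z i k)
    (hB : ∀ k j, Measurable fun z => B z k j) (i : ι) (j : m) :
    Measurable fun z => (A z * B z) i j := by
  simp only [Matrix.mul_apply]
  exact Finset.measurable_sum _ fun k _ => (hA i k).mul (hB k j)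

lemma measurable_mulVec_entry {ι κ : Type*} [Fintype κ] {A : E → Matrix ι κ ℝ}
    {v : E → κ → ℝ} (hA : ∀ i k, Measurable fun z => A z i k)
    (hv : ∀ k, Measurable fun z => v z k) (i : ι) :
    Measurable fun z => (A z *ᵥ v z) i := by
  simp only [Matrix.mulVec, dotProduct]
  exact Finset.measurable_sum _ fun k _ => (hA i k).mul (hv k)

lemma measurable_hatMatrix_entry {ι m : Type*} [Fintype m] [Fintype ι] [DecidableEq ι]
    {A : E → Matrix m ι ℝ} (hA : ∀ i k, Measurable fun z => A z i k) (i j : m) :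
    Measurable fun z => hatMatrix (A z) i j :=
  measurable_mul_entry (measurable_mul_entry hA
    (measurable_inv_entry (measurable_mul_entry (fun k i => hA i k) hA))) (fun k i => hA i k) i j

lemma measurable_leastSquares_entry {ι m : Type*} [Fintype m] [Fintype ι] [DecidableEq ι]
    {A : E → Matrix m ι ℝ} {e : E → m → ℝ} (hA : ∀ i k, Measurable fun z => A z i k)
    (he : ∀ i, Measurable fun z => e z i) (k : ι) :
    Measurable fun z => leastSquares (A z) (e z) k :=
  measurable_mulVec_entry
    (measurable_inv_entry (measurable_mul_entry (fun k i => hA i k) hA))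
    (measurable_mulVec_entry (fun k i => hA i k) he) k

lemma measurable_oracleEstimator {n p : ℕ} (M : Set (Fin p)) :
    Measurable (oracleEstimator M : (Fin n → Fin p → ℝ) × (Fin n → ℝ) → Fin p → ℝ) := by
  classical
  refine measurable_pi_lambda _ fun j => ?_
  unfold oracleEstimator
  by_cases h : j ∈ M
  · simp only [h, dif_pos]
    exact measurable_leastSquares_entry
      (fun i k => (measurable_pi_apply k.1).comp ((measurable_pi_apply i).comp measurable_fst))
      (fun i => (measurable_pi_apply i).comp measurable_snd) _
  · simp only [h, dif_neg, not_false_eq_true]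
    exact measurable_const

lemma measurable_plugInVariance {n p : ℕ} {X : E → Matrix (Fin n) (Fin p) ℝ} {y : E → Fin n → ℝ}
    {b : E → Fin p → ℝ} (hX : ∀ i j, Measurable fun z => X z i j)
    (hy : ∀ i, Measurable fun z => y z i) (hb : ∀ j, Measurable fun z => b z j) :
    Measurable fun z => plugInVariance (X z) (y z) (b z) := by
  classical
  have hcard : ∀ z, ((model (b z)).ncard : ℝ) = ∑ j, if b z j ≠ 0 then (1 : ℝ) else 0 := by
    intro z
    rw [Finset.sum_boole, Set.ncard_eq_toFinset_card']
    congr 2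
    ext j
    rw [Set.mem_toFinset]
    simp [model]
  unfold plugInVariance
  simp only [hcard]
  refine (Finset.measurable_sum _ fun i _ => ?_).div
    (measurable_const.sub (Finset.measurable_sum _ fun j _ => ?_))
  · exact ((hy i).sub (measurable_mulVec_entry hX hb i)).pow_const 2
  · exact Measurable.ite ((hb j) (measurableSet_singleton 0).compl) measurable_const
      measurable_const

end Measurability

/-- Tonelli form of conditioning on the design; as a lower integral it needs no integrability. -/
lemma lintegral_comp_of_indepFun {Ω α β : Type*} [MeasurableSpace Ω] [MeasurableSpace α]
    [MeasurableSpace β] {P : Measure Ω} [IsProbabilityMeasure P] {f : Ω → α} {g : Ω → β}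
    (h : IndepFun f g P) (hf : Measurable f) (hg : Measurable g) {F : α × β → ℝ≥0∞}
    (hF : Measurable F) :
    ∫⁻ ω, F (f ω, g ω) ∂P = ∫⁻ ω, ∫⁻ y, F (f ω, y) ∂(P.map g) ∂P := by
  have : IsProbabilityMeasure (P.map g) := Measure.isProbabilityMeasure_map hg.aemeasurable
  rw [← lintegral_map (f := F) hF (hf.prodMk hg),
    (indepFun_iff_map_prod_eq_prod_map_map hf.aemeasurable hg.aemeasurable).1 h,
    lintegral_prod _ hF.aemeasurable, lintegral_map hF.lintegral_prod_right' hf]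

/-! ### Second moments of centred quadratic forms -/

section CentredProd

variable {m : Type*} [DecidableEq m]

/-- The centred product `e i * e j - E (e i * e j)` for errors with variance `v`. -/
def centredProd (v : ℝ) (q : m × m) (e : m → ℝ) : ℝ :=
  e q.1 * e q.2 - if q.1 = q.2 then v else 0

lemma measurable_centredProd (v : ℝ) (q : m × m) : Measurable (centredProd v q) :=
  ((measurable_pi_apply q.1).mul (measurable_pi_apply q.2)).sub_const _

lemma centredProd_sq_le (v : ℝ) (hv : 0 ≤ v) (q : m × m) (e : m → ℝ) :
    centredProd v q e ^ 2 ≤ (e q.1 ^ 4 + e q.2 ^ 4) / 2 + v ^ 2 := by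
  obtain ⟨i, j⟩ := q
  unfold centredProd
  by_cases hij : i = j
  · subst hij
    simp only [if_true]
    nlinarith [mul_nonneg hv (sq_nonneg (e i))]
  · simp only [hij, if_false]
    nlinarith [sq_nonneg (e i ^ 2 - e j ^ 2), sq_nonneg v]

end CentredProd

section QuadraticForm

variable {m : Type*} [Fintype m] {ν : Measure ℝ} [IsProbabilityMeasure ν]

lemma integral_comp_eval {φ : ℝ → ℝ} (hφ : Measurable φ) (k : m) :
    ∫ e : m → ℝ, φ (e k) ∂(Measure.pi fun _ : m => ν) = ∫ x, φ x ∂ν := by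
  have h := (measurePreserving_eval (fun _ : m => ν) k).map_eq
  conv_rhs => rw [← h]
  rw [integral_map (measurable_pi_apply k).aemeasurable hφ.aestronglyMeasurable]

lemma integrable_eval_pow_four (h4 : Integrable (fun x => x ^ 4) ν) (k : m) :
    Integrable (fun e : m → ℝ => e k ^ 4) (Measure.pi fun _ : m => ν) :=
  (measurePreserving_eval (fun _ : m => ν) k).integrable_comp_of_integrable h4

variable [DecidableEq m]

/-- Coordinate `k` is independent of the remaining ones, on which alone `G` depends, so the integral
factors through the zero mean of `φ`. -/
lemma integral_pi_mul_eq_zero {φ : ℝ → ℝ} (hφm : Measurable φ) (hφ : ∫ x, φ x ∂ν = 0)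
    (k : m) {G : (m → ℝ) → ℝ} (hGm : Measurable G) (hG : ∀ e t, G (Function.update e k t) = G e) :
    ∫ e, φ (e k) * G e ∂(Measure.pi fun _ : m => ν) = 0 := by
  have hind : iIndepFun (fun (i : m) (e : m → ℝ) => e i) (Measure.pi fun _ : m => ν) :=
    iIndepFun_pi (X := fun _ x => x) fun _ => aemeasurable_id
  let S : Finset m := Finset.univ.erase k
  have h1 := hind.indepFun_finset {k} S (by simp [S])
    (fun i => measurable_pi_apply i)
  -- The missing coordinate is filled with `0`; the value is irrelevant because `G` ignores it.
  let ext : (S → ℝ) → m → ℝ := fun r i =>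
    if h : i ∈ S then r ⟨i, h⟩ else 0
  have hext : Measurable ext := by
    refine measurable_pi_lambda _ fun i => ?_
    by_cases h : i ∈ S
    · simp only [ext, h, dif_pos]
      exact measurable_pi_apply _
    · simp only [ext, h, dif_neg, not_false_eq_true]
      exact measurable_const
  have h2 := h1.comp (φ := fun r : ({k} : Finset m) → ℝ => φ (r ⟨k, by simp⟩)) (ψ := fun r => G (ext r))
    (hφm.comp (measurable_pi_apply _)) (hGm.comp hext)
  have h3 : ∀ e : m → ℝ, G (ext fun i => e i) = G e := by
    intro e
    rw [← hG e 0]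
    congr 1
    ext i
    by_cases hi : i = k
    · subst hi; simp [ext, S]
    · simp [ext, S, hi]
  have h4 := h2.integral_fun_mul_eq_mul_integral
    (hφm.comp ((measurable_pi_apply _).comp
      (measurable_pi_lambda _ fun i => measurable_pi_apply _))).aestronglyMeasurable
    ((hGm.comp hext).comp
      (measurable_pi_lambda _ fun i => measurable_pi_apply _)).aestronglyMeasurable
  simp only [Function.comp_def, h3] at h4
  rw [h4, integral_comp_eval hφm, hφ, zero_mul]

/-- If the unordered pairs differ, either some index occurs in just one of the four positions and
its mean-zero error factors out (`key`), or both pairs are diagonal and `e i ^ 2 - v` factors out.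
-/
lemma integral_centredProd_mul_eq_zero (h1 : ∫ x, x ∂ν = 0) {v : ℝ} (h2 : ∫ x, (x ^ 2 - v) ∂ν = 0)
    {q r : m × m} (hqr : r ≠ q) (hqr' : r ≠ q.swap) :
    ∫ e, centredProd v q e * centredProd v r e ∂(Measure.pi fun _ : m => ν) = 0 := by
  have key : ∀ {i j k l : m}, i ≠ j → i ≠ k → i ≠ l →
      ∫ e, centredProd v (i, j) e * centredProd v (k, l) e ∂(Measure.pi fun _ : m => ν) = 0 := by
    intro i j k l hij hik hil
    rw [← integral_pi_mul_eq_zero measurable_id h1 i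
      (G := fun e => e j * centredProd v (k, l) e)
      ((measurable_pi_apply _).mul (measurable_centredProd _ _))
      (fun e t => by simp [centredProd, Ne.symm hij, Ne.symm hik, Ne.symm hil])]
    refine integral_congr_ae (ae_of_all _ fun e => ?_)
    simp [centredProd, hij]
    ring
  have hswap : ∀ (i j : m) e, centredProd v (i, j) e = centredProd v (j, i) e := by
    intro i j e
    simp only [centredProd, mul_comm (e i), eq_comm (a := i)]
  obtain ⟨i, j⟩ := q
  obtain ⟨k, l⟩ := r
  simp only [ne_eq, Prod.mk.injEq, Prod.swap_prod_mk, not_and] at hqr hqr'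
  by_cases hij : i = j
  · subst hij
    by_cases hkl : k = l
    · subst hkl
      have hki : k ≠ i := fun h => hqr h h
      rw [← integral_pi_mul_eq_zero (φ := fun x => x ^ 2 - v) (by fun_prop) h2 i
        (G := fun e => centredProd v (k, k) e) (measurable_centredProd _ _)
        (fun e t => by simp [centredProd, hki])]
      refine integral_congr_ae (ae_of_all _ fun e => ?_)
      simp [centredProd, sq]
    · simp_rw [mul_comm (centredProd v (i, i) _)]
      by_cases hki : k = i
      · have hli : l ≠ i := fun h => hkl (hki.trans h.symm)
        simp_rw [hswap k l]
        exact key (Ne.symm hkl) hli hli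
      · exact key hkl hki hki
  · by_cases hik : i = k
    · subst hik
      have hjl : j ≠ l := fun h => hqr rfl h.symm
      simp_rw [hswap i j]
      exact key (Ne.symm hij) (Ne.symm hij) hjl
    · by_cases hil : i = l
      · subst hil
        have hjk : j ≠ k := fun h => hqr' h.symm rfl
        simp_rw [hswap i j]
        exact key (Ne.symm hij) hjk (Ne.symm hij)
      · exact key hij hik hil

lemma integrable_centredProd_sq (h4 : Integrable (fun x => x ^ 4) ν) {v : ℝ} (hv : 0 ≤ v)
    (q : m × m) :
    Integrable (fun e => centredProd v q e ^ 2) (Measure.pi fun _ : m => ν) := by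
  refine Integrable.mono' ((((integrable_eval_pow_four h4 q.1).add
    (integrable_eval_pow_four h4 q.2)).div_const 2).add (integrable_const (v ^ 2)))
    ((measurable_centredProd v q).pow_const 2).aestronglyMeasurable (ae_of_all _ fun e => ?_)
  rw [Real.norm_of_nonneg (sq_nonneg _)]
  exact centredProd_sq_le v hv q e

lemma integral_centredProd_sq_le (h4 : Integrable (fun x => x ^ 4) ν) {v : ℝ} (hv : 0 ≤ v)
    (q : m × m) :
    ∫ e, centredProd v q e ^ 2 ∂(Measure.pi fun _ : m => ν) ≤ ∫ x, x ^ 4 ∂ν + v ^ 2 := by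
  have hk : ∀ k : m, ∫ e : m → ℝ, e k ^ 4 ∂(Measure.pi fun _ : m => ν) = ∫ x, x ^ 4 ∂ν := fun k => integral_comp_eval (φ := fun x => x ^ 4) (by fun_prop) k
  have i1 := integrable_eval_pow_four h4 q.1
  have i2 := integrable_eval_pow_four h4 q.2
  calc _ ≤ ∫ e : m → ℝ, ((e q.1 ^ 4 + e q.2 ^ 4) / 2 + v ^ 2) ∂(Measure.pi fun _ : m => ν) :=
        integral_mono (integrable_centredProd_sq h4 hv q)
          (((i1.add i2).div_const 2).add (integrable_const _)) (centredProd_sq_le v hv q)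
    _ = _ := by
        have i3 : Integrable (fun e : m → ℝ => (e q.1 ^ 4 + e q.2 ^ 4) / 2)
            (Measure.pi fun _ : m => ν) := (i1.add i2).div_const 2
        rw [integral_add i3 (integrable_const _), integral_div, integral_add i1 i2, hk, hk]
        simp

/-- The centred quadratic form `∑ h i j (e i * e j - E (e i * e j))`. -/
def centredForm (v : ℝ) (h : m → m → ℝ) (e : m → ℝ) : ℝ :=
  ∑ q : m × m, h q.1 q.2 * centredProd v q e

/-- Orthogonality of the centred products leaves only the terms with `r = q` and `r = q.swap` in the
double sum. These account for the factor `2`. -/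
lemma integral_centredForm_sq_le (h1 : ∫ x, x ∂ν = 0) {v : ℝ} (hv : 0 ≤ v)
    (h2 : ∫ x, (x ^ 2 - v) ∂ν = 0) (h4 : Integrable (fun x => x ^ 4) ν) (h : m → m → ℝ) :
    Integrable (fun e => centredForm v h e ^ 2) (Measure.pi fun _ : m => ν) ∧
    ∫ e, centredForm v h e ^ 2 ∂(Measure.pi fun _ : m => ν) ≤
      2 * (∫ x, x ^ 4 ∂ν + v ^ 2) * ∑ i, ∑ j, h i j ^ 2 := by
  set π := Measure.pi fun _ : m => ν with hπ
  set K := ∫ x, x ^ 4 ∂ν + v ^ 2 with hK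
  have hK0 : 0 ≤ K := add_nonneg (integral_nonneg fun x => by positivity) (sq_nonneg v)
  have hint : ∀ q r : m × m, Integrable (fun e => centredProd v q e * centredProd v r e) π := by
    intro q r
    refine Integrable.mono' (((integrable_centredProd_sq h4 hv q).add
      (integrable_centredProd_sq h4 hv r)).div_const 2)
      ((measurable_centredProd v q).mul (measurable_centredProd v r)).aestronglyMeasurable
      (ae_of_all _ fun e => ?_)
    simp only [Pi.add_apply]
    rw [Real.norm_eq_abs, abs_le]
    constructor <;> nlinarith [sq_nonneg (centredProd v q e - centredProd v r e),
      sq_nonneg (centredProd v q e + centredProd v r e)]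
  have hexp : ∀ e, centredForm v h e ^ 2 = ∑ q : m × m, ∑ r : m × m,
      h q.1 q.2 * h r.1 r.2 * (centredProd v q e * centredProd v r e) := by
    intro e
    rw [sq, centredForm, Finset.sum_mul_sum]
    exact Finset.sum_congr rfl fun q _ => Finset.sum_congr rfl fun r _ => by ring
  simp_rw [hexp]
  have hint' : ∀ q ∈ (Finset.univ : Finset (m × m)), ∀ r ∈ (Finset.univ : Finset (m × m)),
      Integrable (fun e =>
        h q.1 q.2 * h r.1 r.2 * (centredProd v q e * centredProd v r e)) π :=
    fun q _ r _ => (hint q r).const_mul _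
  refine ⟨integrable_finsetSum _ fun q hq => integrable_finsetSum _ fun r hr =>
    hint' q hq r hr, ?_⟩
  rw [integral_finsetSum _ fun q hq => integrable_finsetSum _ (hint' q hq)]
  -- When `q` is diagonal both indicators fire; the duplicate is nonnegative and harmless in an
  -- upper bound.
  have hterm : ∀ q r : m × m,
      ∫ e, h q.1 q.2 * h r.1 r.2 * (centredProd v q e * centredProd v r e) ∂π ≤
      (if r = q then K * h q.1 q.2 ^ 2 else 0) +
      (if r = q.swap then K * ((h q.1 q.2 ^ 2 + h r.1 r.2 ^ 2) / 2) else 0) := by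
    intro q r
    rw [integral_const_mul]
    have hsq : ∫ e, centredProd v q e * centredProd v q e ∂π ≤ K := by
      simp_rw [← sq]
      exact integral_centredProd_sq_le h4 hv q
    have hsq0 : 0 ≤ ∫ e, centredProd v q e * centredProd v q e ∂π :=
      integral_nonneg fun e => mul_self_nonneg _
    by_cases hr : r = q
    · subst hr
      have : 0 ≤ if r = r.swap then K * ((h r.1 r.2 ^ 2 + h r.1 r.2 ^ 2) / 2) else 0 := by
        split_ifs <;> positivity
      simp only [if_true]
      nlinarith [mul_le_mul_of_nonneg_left hsq (mul_self_nonneg (h r.1 r.2))]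
    · by_cases hr' : r = q.swap
      · subst hr'
        have hcs : ∀ e, centredProd v q.swap e = centredProd v q e := by
          intro e
          simp only [centredProd, Prod.fst_swap, Prod.snd_swap, mul_comm (e q.2),
            eq_comm (a := q.2)]
        simp only [hr, if_false, if_true, zero_add, hcs, Prod.fst_swap, Prod.snd_swap]
        have h3 : h q.1 q.2 * h q.2 q.1 ≤ (h q.1 q.2 ^ 2 + h q.2 q.1 ^ 2) / 2 := by
          nlinarith [sq_nonneg (h q.1 q.2 - h q.2 q.1)]
        calc _ ≤ (h q.1 q.2 ^ 2 + h q.2 q.1 ^ 2) / 2 *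
              ∫ e, centredProd v q e * centredProd v q e ∂π := by gcongr
          _ ≤ (h q.1 q.2 ^ 2 + h q.2 q.1 ^ 2) / 2 * K := by gcongr
          _ = _ := by ring
      · rw [integral_centredProd_mul_eq_zero h1 h2 hr hr']
        simp [hr, hr']
  calc _ ≤ ∑ q : m × m, (K * h q.1 q.2 ^ 2 + K * ((h q.1 q.2 ^ 2 + h q.2 q.1 ^ 2) / 2)) := by
        refine Finset.sum_le_sum fun q _ => ?_
        rw [integral_finsetSum _ (hint' q (Finset.mem_univ q))]
        refine (Finset.sum_le_sum fun r _ => hterm q r).trans ?_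
        rw [Finset.sum_add_distrib]
        simp
    _ = 2 * K * ∑ i, ∑ j, h i j ^ 2 := by
        have e1 : ∑ q : m × m, h q.1 q.2 ^ 2 = ∑ i, ∑ j, h i j ^ 2 :=
          Fintype.sum_prod_type _
        have e2 : ∑ q : m × m, h q.2 q.1 ^ 2 = ∑ i, ∑ j, h i j ^ 2 := by
          rw [Fintype.sum_prod_type, Finset.sum_comm]
        rw [Finset.sum_add_distrib, ← Finset.mul_sum, ← Finset.mul_sum, ← Finset.sum_div,
          Finset.sum_add_distrib, e1, e2]
        ring

end QuadraticForm

/-- Chebyshev after freezing the design: the conditional second moment is bounded uniformly because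
the Frobenius norm is. -/
lemma measure_le_abs_centredForm_le {Ω α m : Type*} [MeasurableSpace Ω] [MeasurableSpace α]
    [Fintype m] [DecidableEq m] {P : Measure Ω} [IsProbabilityMeasure P]
    {ν : Measure ℝ} [IsProbabilityMeasure ν]
    (h1 : ∫ x, x ∂ν = 0) {v : ℝ} (hv : 0 ≤ v)
    (h2 : ∫ x, (x ^ 2 - v) ∂ν = 0) (h4 : Integrable (fun x => x ^ 4) ν)
    {f : Ω → α} {e : Ω → m → ℝ} (hf : Measurable f) (he : Measurable e)
    (hind : IndepFun f e P) (hlaw : P.map e = Measure.pi fun _ => ν)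
    {h : α → m → m → ℝ} (hh : ∀ i j, Measurable fun a => h a i j) {C : ℝ}
    (hC : ∀ a, ∑ i, ∑ j, h a i j ^ 2 ≤ C) {τ : ℝ} (hτ : 0 < τ) :
    P {ω | τ ≤ |centredForm v (h (f ω)) (e ω)|} ≤
      ENNReal.ofReal (2 * (∫ x, x ^ 4 ∂ν + v ^ 2) * C / τ ^ 2) := by
  have hm : Measurable fun z : α × (m → ℝ) => centredForm v (h z.1) z.2 := by
    unfold centredForm
    exact Finset.measurable_sum _ fun q _ => ((hh q.1 q.2).comp measurable_fst).mul
      ((measurable_centredProd v q).comp measurable_snd)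
  have hF : Measurable fun z : α × (m → ℝ) => ENNReal.ofReal (centredForm v (h z.1) z.2 ^ 2) :=
    (hm.pow_const 2).ennreal_ofReal
  have hK : 0 ≤ ∫ x, x ^ 4 ∂ν + v ^ 2 :=
    add_nonneg (integral_nonneg fun x => by positivity) (sq_nonneg v)
  have hlint : ∫⁻ ω, ENNReal.ofReal (centredForm v (h (f ω)) (e ω) ^ 2) ∂P ≤
      ENNReal.ofReal (2 * (∫ x, x ^ 4 ∂ν + v ^ 2) * C) := by
    rw [lintegral_comp_of_indepFun hind hf he hF, hlaw]
    calc _ ≤ ∫⁻ _, ENNReal.ofReal (2 * (∫ x, x ^ 4 ∂ν + v ^ 2) * C) ∂P := by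
          refine lintegral_mono fun ω => ?_
          obtain ⟨hi, hle⟩ := integral_centredForm_sq_le (m := m) h1 hv h2 h4 (h (f ω))
          rw [← ofReal_integral_eq_lintegral_ofReal hi (ae_of_all _ fun e => sq_nonneg _)]
          refine ENNReal.ofReal_le_ofReal (hle.trans ?_)
          have := hC (f ω)
          gcongr
      _ = _ := by simp
  have hset : {ω | τ ≤ |centredForm v (h (f ω)) (e ω)|} =
      {ω | ENNReal.ofReal (τ ^ 2) ≤ ENNReal.ofReal (centredForm v (h (f ω)) (e ω) ^ 2)} := by
    ext ω
    simp only [Set.mem_ofPred_eq]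
    rw [ENNReal.ofReal_le_ofReal_iff (sq_nonneg _), sq_le_sq, abs_of_pos hτ]
  rw [hset, ENNReal.ofReal_div_of_pos (by positivity)]
  refine (meas_ge_le_lintegral_div (hF.comp (hf.prodMk he)).aemeasurable (by simpa using hτ.ne')
    ENNReal.ofReal_ne_top).trans ?_
  gcongr
  exact hlint

/-! ### Exponential moments -/

/-- Second-order Taylor bound. With `|t| ≤ 1 / (2 * B)` the remainder uses only half of the exponent
`|z| / B`; the other half absorbs the factor `z ^ 2`. -/
lemma exp_mul_le {B z t : ℝ} (hB : 0 < B) (ht : |t| ≤ 1 / (2 * B)) :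
    Real.exp (t * z) ≤ 1 + t * z + 8 * B ^ 2 * t ^ 2 * Real.exp (|z| / B) := by
  have h1 := Complex.norm_exp_sub_sum_le_norm_mul_exp ((t * z : ℝ) : ℂ) 2
  rw [Finset.sum_range_succ, Finset.sum_range_one] at h1
  have h1' : |Real.exp (t * z) - (1 + t * z)| ≤ |t * z| ^ 2 * Real.exp |t * z| := by
    have e1 : Complex.exp ((t * z : ℝ) : ℂ) - (((t * z : ℝ) : ℂ) ^ 0 / (Nat.factorial 0 : ℕ) +
        ((t * z : ℝ) : ℂ) ^ 1 / (Nat.factorial 1 : ℕ)) =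
        ((Real.exp (t * z) - (1 + t * z) : ℝ) : ℂ) := by
      push_cast
      simp
    rwa [e1, Complex.norm_real, Complex.norm_real, Real.norm_eq_abs, Real.norm_eq_abs] at h1
  set w := |z| / B with hw
  have hw0 : 0 ≤ w := by positivity
  have hzw : |z| = w * B := by rw [hw]; field_simp
  have h2 : |t * z| ≤ w / 2 := by
    rw [abs_mul, hzw]
    calc |t| * (w * B) ≤ 1 / (2 * B) * (w * B) := by gcongr
      _ = w / 2 := by field_simp
  -- The `8` comes from `x ^ 2 / 2 ≤ exp x` at `x = w / 2`.
  have h3 : w ^ 2 ≤ 8 * Real.exp (w / 2) := by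
    have := Real.quadratic_le_exp_of_nonneg (x := w / 2) (by positivity)
    nlinarith
  have h4 : |t * z| ^ 2 * Real.exp |t * z| ≤ 8 * B ^ 2 * t ^ 2 * Real.exp w := by
    calc |t * z| ^ 2 * Real.exp |t * z| ≤ |t * z| ^ 2 * Real.exp (w / 2) := by gcongr
      _ = t ^ 2 * B ^ 2 * w ^ 2 * Real.exp (w / 2) := by rw [abs_mul, mul_pow, sq_abs, hzw]; ring
      _ ≤ t ^ 2 * B ^ 2 * (8 * Real.exp (w / 2)) * Real.exp (w / 2) := by gcongr
      _ = 8 * B ^ 2 * t ^ 2 * (Real.exp (w / 2) * Real.exp (w / 2)) := by ring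
      _ = _ := by rw [← Real.exp_add]; ring_nf
  have := (le_abs_self _).trans (h1'.trans h4)
  linarith

/-- Mean zero removes the linear Taylor term, and `1 + u ≤ exp u` makes the bound multiplicative
over independent factors. -/
lemma lintegral_exp_mul_le {Ω : Type*} [MeasurableSpace Ω] {P : Measure Ω}
    [IsProbabilityMeasure P] {Z : Ω → ℝ} (hZ : Measurable Z) (hmean : ∫ ω, Z ω ∂P = 0)
    {B b : ℝ} (hB : 0 < B) (hb : 0 ≤ b)
    (h : ∫⁻ ω, ENNReal.ofReal (Real.exp (|Z ω| / B)) ∂P ≤ ENNReal.ofReal b) {t : ℝ}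
    (ht : |t| ≤ 1 / (2 * B)) :
    ∫⁻ ω, ENNReal.ofReal (Real.exp (t * Z ω)) ∂P ≤
      ENNReal.ofReal (Real.exp (8 * B ^ 2 * b * t ^ 2)) := by
  have hme : Measurable fun ω => Real.exp (|Z ω| / B) :=
    Real.measurable_exp.comp ((continuous_abs.measurable.comp hZ).div_const B)
  have hie : Integrable (fun ω => Real.exp (|Z ω| / B)) P := by
    refine ⟨hme.aestronglyMeasurable, ?_⟩
    rw [hasFiniteIntegral_iff_ofReal (ae_of_all _ fun ω => (Real.exp_pos _).le)]
    exact h.trans_lt ENNReal.ofReal_lt_top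
  have hbe : ∫ ω, Real.exp (|Z ω| / B) ∂P ≤ b := by
    rw [← ENNReal.ofReal_le_ofReal_iff hb,
      ofReal_integral_eq_lintegral_ofReal hie (ae_of_all _ fun ω => (Real.exp_pos _).le)]
    exact h
  have hiZ : Integrable Z P := by
    refine (hie.const_mul B).mono' hZ.aestronglyMeasurable (ae_of_all _ fun ω => ?_)
    have := Real.add_one_le_exp (|Z ω| / B)
    have h2 : |Z ω| = B * (|Z ω| / B) := by field_simp
    rw [Real.norm_eq_abs]
    nlinarith
  have hi2 : Integrable (fun ω => 1 + t * Z ω + 8 * B ^ 2 * t ^ 2 * Real.exp (|Z ω| / B)) P :=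
    ((integrable_const 1).add (hiZ.const_mul t)).add (hie.const_mul _)
  have hnn : ∀ ω, 0 ≤ 1 + t * Z ω + 8 * B ^ 2 * t ^ 2 * Real.exp (|Z ω| / B) := fun ω =>
    (Real.exp_pos _).le.trans (exp_mul_le hB ht)
  calc _ ≤ ∫⁻ ω, ENNReal.ofReal (1 + t * Z ω + 8 * B ^ 2 * t ^ 2 * Real.exp (|Z ω| / B)) ∂P :=
        lintegral_mono fun ω => ENNReal.ofReal_le_ofReal (exp_mul_le hB ht)
    _ = ENNReal.ofReal (∫ ω, (1 + t * Z ω + 8 * B ^ 2 * t ^ 2 * Real.exp (|Z ω| / B)) ∂P) :=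
        (ofReal_integral_eq_lintegral_ofReal hi2 (ae_of_all _ hnn)).symm
    _ ≤ _ := by
        refine ENNReal.ofReal_le_ofReal ?_
        have i1 : Integrable (fun ω => 1 + t * Z ω) P :=
          (integrable_const 1).add (hiZ.const_mul t)
        rw [integral_add i1 (hie.const_mul _), integral_add (integrable_const 1) (hiZ.const_mul t),
          integral_const_mul, integral_const_mul, hmean]
        have h3 := Real.add_one_le_exp (8 * B ^ 2 * b * t ^ 2)
        have h4 : 8 * B ^ 2 * t ^ 2 * ∫ ω, Real.exp (|Z ω| / B) ∂P ≤ 8 * B ^ 2 * t ^ 2 * b := by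
          gcongr
        simp only [integral_const, probReal_univ, smul_eq_mul, mul_one, mul_zero, add_zero]
        linarith

/-- Young's inequality bounds `u * v` by a convex combination of `u ^ α` and `v ^ α'`, hence by the
larger. The exponent condition says `α' ≤ θ`, so `v ^ α' ≤ 1 + v ^ θ`; the `1` becomes the factor
`exp 1`. -/
lemma exp_mul_le_add_of_conjugate {α θ u v : ℝ} (hα : 1 < α) (hθ : 0 < θ)
    (hαθ : 1 / α + 1 / θ ≤ 1) (hu : 0 ≤ u) (hv : 0 ≤ v) :
    Real.exp (u * v) ≤ Real.exp (u ^ α) + Real.exp 1 * Real.exp (v ^ θ) := by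
  have hconj := Real.HolderConjugate.conjExponent hα
  set α' := Real.conjExponent α with hα'
  have hα'0 : 0 < α' := hconj.symm.pos
  have hsum : 1 / α + 1 / α' = 1 := by simpa using hconj.inv_add_inv_eq_one
  have hle : α' ≤ θ := by
    rw [← one_div_le_one_div hθ hα'0]
    linarith
  have hv' : v ^ α' ≤ 1 + v ^ θ := by
    rcases le_total v 1 with h | h
    · have h1 := Real.rpow_le_one hv h hα'0.le
      have h2 := Real.rpow_nonneg hv θ
      linarith
    · have := Real.rpow_le_rpow_of_exponent_le h hle
      linarith
  have hy := Real.young_inequality_of_nonneg hu hv hconj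
  have hα0 : 0 < α := by linarith
  rcases le_total (u ^ α) (v ^ α') with h | h
  · have h1 : u * v ≤ 1 + v ^ θ := by
      calc u * v ≤ u ^ α / α + v ^ α' / α' := hy
        _ ≤ v ^ α' / α + v ^ α' / α' := by gcongr
        _ = v ^ α' * (1 / α + 1 / α') := by ring
        _ ≤ 1 + v ^ θ := by rw [hsum, mul_one]; exact hv'
    have h2 := Real.exp_le_exp.2 h1
    rw [Real.exp_add] at h2
    have := Real.exp_pos (u ^ α)
    linarith
  · have h1 : u * v ≤ u ^ α := by
      calc u * v ≤ u ^ α / α + v ^ α' / α' := hy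
        _ ≤ u ^ α / α + u ^ α / α' := by gcongr
        _ = u ^ α * (1 / α + 1 / α') := by ring
        _ = u ^ α := by rw [hsum, mul_one]
    have h2 := Real.exp_le_exp.2 h1
    have := mul_pos (Real.exp_pos 1) (Real.exp_pos (v ^ θ))
    linarith

lemma integrable_pow_four_of_errorExpMoment {ν : Measure ℝ} [IsProbabilityMeasure ν] {θ : ℝ}
    (hθ : 0 < θ) (h : ErrorExpMoment ν θ) : Integrable (fun e : ℝ => e ^ 4) ν := by
  obtain ⟨A, b, hA, -, hle⟩ := h
  have hm : Measurable fun e : ℝ => Real.exp ((|e| / A) ^ θ) := by fun_prop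
  have hie : Integrable (fun e : ℝ => Real.exp ((|e| / A) ^ θ)) ν := by
    refine ⟨hm.aestronglyMeasurable, ?_⟩
    rw [hasFiniteIntegral_iff_ofReal (ae_of_all _ fun ω => (Real.exp_pos _).le)]
    exact hle.trans_lt ENNReal.ofReal_lt_top
  -- For small `θ` a high term of the exponential series is needed: `k` is chosen with `θ * k ≥ 4`.
  obtain ⟨k, hk⟩ := exists_nat_ge (4 / θ)
  have hk' : 4 ≤ θ * k := by rw [div_le_iff₀ hθ] at hk; linarith
  refine ((hie.const_mul (k.factorial * A ^ 4)).add (integrable_const (A ^ 4))).mono'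
    (by fun_prop) (ae_of_all _ fun e => ?_)
  set w := |e| / A with hw
  have hw0 : 0 ≤ w := by positivity
  have he : ‖e ^ 4‖ = A ^ 4 * w ^ 4 := by
    rw [norm_pow, Real.norm_eq_abs, hw]
    field_simp
  simp only [Pi.add_apply]
  rw [he]
  have h2 : w ^ 4 ≤ k.factorial * Real.exp (w ^ θ) + 1 := by
    have h3 : (w ^ θ) ^ k ≤ k.factorial * Real.exp (w ^ θ) := by
      have := Real.pow_div_factorial_le_exp (w ^ θ) (Real.rpow_nonneg hw0 θ) k
      rw [div_le_iff₀ (by positivity)] at this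
      linarith
    rcases le_total w 1 with h | h
    · have : w ^ 4 ≤ 1 := pow_le_one₀ hw0 h
      have h4 : 0 ≤ (w ^ θ) ^ k := pow_nonneg (Real.rpow_nonneg hw0 θ) _
      linarith
    · have h5 : w ^ (4 : ℕ) ≤ (w ^ θ) ^ k := by
        rw [← Real.rpow_natCast, ← Real.rpow_natCast, ← Real.rpow_mul hw0]
        exact Real.rpow_le_rpow_of_exponent_le h (by exact_mod_cast hk')
      linarith
  calc A ^ 4 * w ^ 4 ≤ A ^ 4 * (k.factorial * Real.exp (w ^ θ) + 1) := by gcongr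
    _ = _ := by ring

/-! ### Exponential bounds for the inner products of columns and errors -/

section Model

variable {Ω : ℕ → Type*} [∀ n, MeasurableSpace (Ω n)] {P : (n : ℕ) → Measure (Ω n)}
  {p : ℕ → ℕ}
  {x : (n : ℕ) → Fin n → Ω n → Fin (p n) → ℝ} {ε : (n : ℕ) → Fin n → Ω n → ℝ}
  {ν : Measure ℝ} {σ : ℝ}

/-- Chernoff at `t` and `-t`, then a union bound over the columns. -/
lemma measure_lt_abs_sum_le {K t₀ : ℝ} (h : ErrorCondition P x ε ν σ)
    (hK : ∀ n j t, |t| ≤ t₀ →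
      ∫⁻ ω, ENNReal.ofReal (Real.exp (t * ∑ i, x n i ω j * ε n i ω)) ∂(P n) ≤
        ENNReal.ofReal (Real.exp (n * (K * t ^ 2))))
    (n : ℕ) {t T : ℝ} (ht0 : 0 < t) (ht : t ≤ t₀) :
    P n {ω | ¬ ∀ j, |∑ i, x n i ω j * ε n i ω| ≤ T} ≤
      ENNReal.ofReal (p n * (2 * Real.exp (n * (K * t ^ 2) - t * T))) := by
  have hone : ∀ (j : Fin (p n)) (s : ℝ), |s| = t →
      P n {ω | t * T ≤ s * ∑ i, x n i ω j * ε n i ω} ≤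
        ENNReal.ofReal (Real.exp (n * (K * t ^ 2) - t * T)) := by
    intro j s hs
    have hm : Measurable fun ω => ENNReal.ofReal
        (Real.exp (s * ∑ i, x n i ω j * ε n i ω)) := by
      refine (Real.measurable_exp.comp (measurable_const.mul
        (Finset.measurable_sum _ fun i _ => ?_))).ennreal_ofReal
      exact ((measurable_pi_apply j).comp (h.measurable_design n i)).mul (h.measurable_error n i)
    have hset : {ω | t * T ≤ s * ∑ i, x n i ω j * ε n i ω} =
        {ω | ENNReal.ofReal (Real.exp (t * T)) ≤
          ENNReal.ofReal (Real.exp (s * ∑ i, x n i ω j * ε n i ω))} := by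
      ext ω
      simp only [Set.mem_ofPred_eq]
      rw [ENNReal.ofReal_le_ofReal_iff (Real.exp_pos _).le, Real.exp_le_exp]
    rw [hset, Real.exp_sub, ENNReal.ofReal_div_of_pos (Real.exp_pos _)]
    refine (meas_ge_le_lintegral_div hm.aemeasurable
      (by simpa using Real.exp_pos _) ENNReal.ofReal_ne_top).trans ?_
    have := hK n j s (hs.trans_le ht)
    rw [show s ^ 2 = t ^ 2 by rw [← sq_abs, hs]] at this
    gcongr
  have hsub : {ω | ¬ ∀ j, |∑ i, x n i ω j * ε n i ω| ≤ T} ⊆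
      ⋃ j : Fin (p n), ({ω | t * T ≤ t * ∑ i, x n i ω j * ε n i ω} ∪
        {ω | t * T ≤ (-t) * ∑ i, x n i ω j * ε n i ω}) := by
    intro ω hω
    simp only [Set.mem_ofPred_eq, not_forall, not_le] at hω
    obtain ⟨j, hj⟩ := hω
    refine Set.mem_iUnion.2 ⟨j, ?_⟩
    rcases lt_abs.1 hj with h1 | h1
    · left
      exact mul_le_mul_of_nonneg_left h1.le ht0.le
    · right
      have := mul_le_mul_of_nonneg_left h1.le ht0.le
      simp only [Set.mem_ofPred_eq]
      linarith
  calc _ ≤ ∑ j : Fin (p n), P n ({ω | t * T ≤ t * ∑ i, x n i ω j * ε n i ω} ∪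
        {ω | t * T ≤ (-t) * ∑ i, x n i ω j * ε n i ω}) :=
        (measure_mono hsub).trans (measure_iUnion_fintype_le _ _)
    _ ≤ ∑ _j : Fin (p n), ENNReal.ofReal (2 * Real.exp (n * (K * t ^ 2) - t * T)) := by
        refine Finset.sum_le_sum fun j _ => (measure_union_le _ _).trans ?_
        rw [two_mul, ENNReal.ofReal_add (Real.exp_pos _).le (Real.exp_pos _).le]
        exact add_le_add (hone j t (abs_of_pos ht0)) (hone j (-t) (by rw [abs_neg, abs_of_pos ht0]))
    _ = _ := by
        rw [Finset.sum_const, Finset.card_univ, Fintype.card_fin, nsmul_eq_mul,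
          ENNReal.ofReal_mul (p := (p n : ℝ)) (Nat.cast_nonneg _), ENNReal.ofReal_natCast]

variable [∀ n, IsProbabilityMeasure (P n)]

lemma ErrorCondition.map_error (h : ErrorCondition P x ε ν σ) (n : ℕ) :
    (P n).map (fun ω i => ε n i ω) = Measure.pi fun _ => ν := by
  rw [(iIndepFun_iff_map_fun_eq_pi_map fun i => (h.measurable_error n i).aemeasurable).1
    (h.indep_error n)]
  simp only [h.law_error]

lemma measurable_expMoment (ν : Measure ℝ) [IsProbabilityMeasure ν] :
    Measurable fun u : ℝ => ∫⁻ e, ENNReal.ofReal (Real.exp (u * e)) ∂ν :=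
  Measurable.lintegral_prod_right (f := fun u e : ℝ => ENNReal.ofReal (Real.exp (u * e)))
    (by fun_prop)

variable [IsProbabilityMeasure ν]

lemma lintegral_exp_sum_eq (h : ErrorCondition P x ε ν σ) (n : ℕ) (j : Fin (p n)) (t : ℝ) :
    ∫⁻ ω, ENNReal.ofReal (Real.exp (t * ∑ i, x n i ω j * ε n i ω)) ∂(P n) =
      ∫⁻ ω, ∏ i, ∫⁻ e, ENNReal.ofReal (Real.exp (t * x n i ω j * e)) ∂ν ∂(P n) := by
  have hF : Measurable fun z : (Fin n → Fin (p n) → ℝ) × (Fin n → ℝ) =>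
      ENNReal.ofReal (Real.exp (t * ∑ i, z.1 i j * z.2 i)) := by fun_prop
  have h1 := lintegral_comp_of_indepFun (h.indep_design n)
    (measurable_pi_lambda _ fun i => h.measurable_design n i)
    (measurable_pi_lambda _ fun i => h.measurable_error n i) hF
  refine h1.trans (lintegral_congr fun ω => ?_)
  rw [h.map_error]
  have hind : iIndepFun (fun (i : Fin n) (e : Fin n → ℝ) =>
      ENNReal.ofReal (Real.exp (t * x n i ω j * e i))) (Measure.pi fun _ : Fin n => ν) :=
    iIndepFun_pi (X := fun i e => ENNReal.ofReal (Real.exp (t * x n i ω j * e)))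
      fun i => by fun_prop
  have h2 := lintegral_prod_eq_prod_lintegral_of_indepFun Finset.univ _ hind
    (fun i => by fun_prop)
  calc _ = ∫⁻ e, ∏ i, ENNReal.ofReal (Real.exp (t * x n i ω j * e i))
        ∂(Measure.pi fun _ : Fin n => ν) := by
        refine lintegral_congr fun e => ?_
        rw [← ENNReal.ofReal_prod_of_nonneg fun i _ => (Real.exp_pos _).le, ← Real.exp_sum,
          Finset.mul_sum]
        simp only [mul_assoc]
    _ = _ := by
        rw [h2]
        refine Finset.prod_congr rfl fun i _ => ?_
        exact (measurePreserving_eval (fun _ : Fin n => ν) i).lintegral_comp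
          (f := fun e => ENNReal.ofReal (Real.exp (t * x n i ω j * e))) (by fun_prop)

lemma prod_ofReal_exp_const (n : ℕ) (r : ℝ) :
    ∏ _i : Fin n, ENNReal.ofReal (Real.exp r) = ENNReal.ofReal (Real.exp (n * r)) := by
  rw [Finset.prod_const, ← ENNReal.ofReal_pow (Real.exp_pos _).le, ← Real.exp_nat_mul]
  simp

lemma exists_expMoment_bound_of_boundedDesign (h : ErrorCondition P x ε ν σ)
    (hx : BoundedDesign P x) (hε : ErrorExpMoment ν 1) :
    ∃ K t₀ : ℝ, 0 < K ∧ 0 < t₀ ∧ ∀ n j t, |t| ≤ t₀ →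
      ∫⁻ ω, ENNReal.ofReal (Real.exp (t * ∑ i, x n i ω j * ε n i ω)) ∂(P n) ≤
        ENNReal.ofReal (Real.exp (n * (K * t ^ 2))) := by
  obtain ⟨L₀, hL₀⟩ := hx
  obtain ⟨A, b, hA, hb, hle⟩ := hε
  simp only [Real.rpow_one] at hle
  -- The given bound may be zero or negative; the maximum makes it usable as a divisor.
  set L := max L₀ 1 with hL
  have hLpos : 0 < L := lt_of_lt_of_le one_pos (le_max_right _ _)
  refine ⟨8 * A ^ 2 * b * L ^ 2, 1 / (2 * A) / L, by positivity, by positivity,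
    fun n j t ht => ?_⟩
  rw [lintegral_exp_sum_eq h]
  calc _ ≤ ∫⁻ _, ENNReal.ofReal (Real.exp (n * (8 * A ^ 2 * b * L ^ 2 * t ^ 2))) ∂(P n) := by
        refine lintegral_mono_ae ?_
        filter_upwards [ae_all_iff.2 fun i => hL₀ n i j] with ω hω
        rw [← prod_ofReal_exp_const]
        refine Finset.prod_le_prod' fun i _ => ?_
        have hxi : |x n i ω j| ≤ L := (hω i).trans (le_max_left _ _)
        refine (lintegral_exp_mul_le measurable_id h.mean_zero hA hb.le hle ?_).trans ?_
        · rw [abs_mul]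
          rw [le_div_iff₀ hLpos] at ht
          exact le_trans (by gcongr) ht
        · refine ENNReal.ofReal_le_ofReal (Real.exp_le_exp.2 ?_)
          have : x n i ω j ^ 2 ≤ L ^ 2 := by
            rw [← sq_abs]
            gcongr
          calc 8 * A ^ 2 * b * (t * x n i ω j) ^ 2
              = 8 * A ^ 2 * b * t ^ 2 * x n i ω j ^ 2 := by ring
            _ ≤ 8 * A ^ 2 * b * t ^ 2 * L ^ 2 := by gcongr
            _ = _ := by ring
    _ = _ := by simp

/-- Without a uniform bound on the entries, the estimate cannot be made design by design.
Independence of the rows lets the expectation over the design factor too, and each product of an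
entry with an error is centred with an exponential moment by Young. -/
lemma exists_expMoment_bound_of_randomDesign (h : ErrorCondition P x ε ν σ) {α θ : ℝ}
    (hα : 1 < α) (hθ : 0 < θ) (hαθ : 1 / α + 1 / θ ≤ 1)
    (hx : RandomDesign P x α) (hε : ErrorExpMoment ν θ) :
    ∃ K t₀ : ℝ, 0 < K ∧ 0 < t₀ ∧ ∀ n j t, |t| ≤ t₀ →
      ∫⁻ ω, ENNReal.ofReal (Real.exp (t * ∑ i, x n i ω j * ε n i ω)) ∂(P n) ≤
        ENNReal.ofReal (Real.exp (n * (K * t ^ 2))) := by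
  obtain ⟨hrows, -, ρ, L, hρ, hL, hxle⟩ := hx
  obtain ⟨A, b, hA, hb, hle⟩ := hε
  set B := ρ * A with hB
  have hBpos : 0 < B := by positivity
  set b' := L + Real.exp 1 * b with hb'
  have hb'pos : 0 < b' := by positivity
  refine ⟨8 * B ^ 2 * b', 1 / (2 * B), by positivity, by positivity, fun n j t ht => ?_⟩
  have hxm : ∀ i, Measurable fun ω => x n i ω j := fun i =>
    (measurable_pi_apply j).comp (h.measurable_design n i)
  have hind : ∀ i, IndepFun (fun ω => x n i ω j) (ε n i) (P n) := fun i =>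
    (h.indep_design n).comp (φ := fun X : Fin n → Fin (p n) → ℝ => X i j)
      (ψ := fun e : Fin n → ℝ => e i) (by fun_prop) (by fun_prop)
  have hεexp : ∀ i, ∫⁻ ω, ENNReal.ofReal (Real.exp ((|ε n i ω| / A) ^ θ)) ∂(P n) ≤
      ENNReal.ofReal b := by
    intro i
    rw [← lintegral_map (f := fun e => ENNReal.ofReal (Real.exp ((|e| / A) ^ θ))) (by fun_prop)
      (h.measurable_error n i), h.law_error]
    exact hle
  have hprod : ∀ i, ∫⁻ ω, ENNReal.ofReal (Real.exp (|x n i ω j * ε n i ω| / B)) ∂(P n) ≤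
      ENNReal.ofReal b' := by
    intro i
    have hem := h.measurable_error n i
    have hxi := hxm i
    calc _ ≤ ∫⁻ ω, (ENNReal.ofReal (Real.exp ((|x n i ω j| / ρ) ^ α)) +
          ENNReal.ofReal (Real.exp 1) * ENNReal.ofReal (Real.exp ((|ε n i ω| / A) ^ θ))) ∂(P n) := by
          refine lintegral_mono fun ω => ?_
          rw [← ENNReal.ofReal_mul (Real.exp_pos _).le,
            ← ENNReal.ofReal_add (Real.exp_pos _).le (by positivity)]
          refine ENNReal.ofReal_le_ofReal ?_
          have e1 : |x n i ω j * ε n i ω| / B = |x n i ω j| / ρ * (|ε n i ω| / A) := by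
            rw [abs_mul, hB]
            field_simp
          rw [e1]
          exact exp_mul_le_add_of_conjugate hα hθ hαθ (by positivity) (by positivity)
      _ = ∫⁻ ω, ENNReal.ofReal (Real.exp ((|x n i ω j| / ρ) ^ α)) ∂(P n) +
          ENNReal.ofReal (Real.exp 1) *
            ∫⁻ ω, ENNReal.ofReal (Real.exp ((|ε n i ω| / A) ^ θ)) ∂(P n) := by
          rw [lintegral_add_left (by fun_prop), lintegral_const_mul _ (by fun_prop)]
      _ ≤ ENNReal.ofReal L + ENNReal.ofReal (Real.exp 1) * ENNReal.ofReal b :=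
          add_le_add (hxle n i j) (mul_le_mul_right (hεexp i) _)
      _ = _ := by
          rw [← ENNReal.ofReal_mul (Real.exp_pos _).le, ← ENNReal.ofReal_add hL.le (by positivity)]
  rw [lintegral_exp_sum_eq h]
  set g : (Fin (p n) → ℝ) → ℝ≥0∞ := fun r =>
    ∫⁻ e, ENNReal.ofReal (Real.exp (t * r j * e)) ∂ν with hg
  have hgm : Measurable g := (measurable_expMoment ν).comp (by fun_prop)
  have hgi : iIndepFun (fun i ω => g (x n i ω)) (P n) := (hrows n).comp (fun _ => g) fun _ => hgm
  calc _ = ∏ i, ∫⁻ ω, g (x n i ω) ∂(P n) :=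
        lintegral_prod_eq_prod_lintegral_of_indepFun Finset.univ (fun i ω => g (x n i ω)) hgi
          fun i => hgm.comp (h.measurable_design n i)
    _ ≤ ∏ _i : Fin n, ENNReal.ofReal (Real.exp (8 * B ^ 2 * b' * t ^ 2)) := by
        refine Finset.prod_le_prod' fun i _ => ?_
        have h1 := lintegral_comp_of_indepFun (hind i) (hxm i) (h.measurable_error n i)
          (F := fun z => ENNReal.ofReal (Real.exp (t * z.1 * z.2))) (by fun_prop)
        rw [h.law_error] at h1
        calc _ = ∫⁻ ω, ENNReal.ofReal (Real.exp (t * (x n i ω j * ε n i ω))) ∂(P n) := by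
              simp only [← mul_assoc]
              exact h1.symm
          _ ≤ _ := by
              refine lintegral_exp_mul_le (Z := fun ω => x n i ω j * ε n i ω) ((hxm i).mul (h.measurable_error n i)) ?_ hBpos hb'pos.le
                (hprod i) ht
              rw [(hind i).integral_fun_mul_eq_mul_integral (hxm i).aestronglyMeasurable
                (h.measurable_error n i).aestronglyMeasurable]
              have : ∫ ω, ε n i ω ∂(P n) = 0 := by
                have h2 := h.mean_zero
                rw [← h.law_error n i] at h2
                rwa [integral_map (h.measurable_error n i).aemeasurable
                  (by fun_prop)] at h2
              rw [this, mul_zero]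
    _ = _ := prod_ofReal_exp_const n _

end Model

/-! ### Convergence in distribution on varying probability spaces -/

lemma tendstoInDistribution_of_map_eq {Ω₁ Ω₂ : ℕ → Type*} {Ω' : Type*}
    [∀ n, MeasurableSpace (Ω₁ n)] [∀ n, MeasurableSpace (Ω₂ n)] [MeasurableSpace Ω']
    {P₁ : (n : ℕ) → Measure (Ω₁ n)} [∀ n, IsProbabilityMeasure (P₁ n)]
    {P₂ : (n : ℕ) → Measure (Ω₂ n)} [∀ n, IsProbabilityMeasure (P₂ n)]
    {μ : Measure Ω'} [IsProbabilityMeasure μ] {l : Filter ℕ}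
    {X : (n : ℕ) → Ω₁ n → ℝ} {Y : (n : ℕ) → Ω₂ n → ℝ} {Z : Ω' → ℝ}
    (h : TendstoInDistribution X l Z P₁ μ) (hY : ∀ n, AEMeasurable (Y n) (P₂ n))
    (heq : ∀ n, (P₂ n).map (Y n) = (P₁ n).map (X n)) :
    TendstoInDistribution Y l Z P₂ μ where
  forall_aemeasurable := hY
  aemeasurable_limit := h.aemeasurable_limit
  tendsto := by
    refine h.tendsto.congr fun n => ?_
    exact Subtype.ext (heq n).symm

/-- **Slutsky's theorem** for random variables on varying probability spaces. -/
lemma tendstoInDistribution_of_sub_tendsto_zero {Ω : ℕ → Type*} {Ω' : Type*}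
    [∀ n, MeasurableSpace (Ω n)] [MeasurableSpace Ω']
    {P : (n : ℕ) → Measure (Ω n)} [∀ n, IsProbabilityMeasure (P n)]
    {μ : Measure Ω'} [IsProbabilityMeasure μ]
    {X Y : (n : ℕ) → Ω n → ℝ} {Z : Ω' → ℝ} (hX : ∀ n, Measurable (X n))
    (hY : ∀ n, Measurable (Y n)) (h : TendstoInDistribution X atTop Z P μ)
    (hsub : ∀ η : ℝ, 0 < η → Tendsto (fun n => P n {ω | η ≤ |Y n ω - X n ω|}) atTop (𝓝 0)) :
    TendstoInDistribution Y atTop Z P μ := by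
  -- Convergence in distribution sees only the individual laws. All variables are moved to one
  -- product space, where the usual Slutsky theorem applies.
  set Q := Measure.infinitePi P with hQ
  have hmap : ∀ {n : ℕ} {f : Ω n → ℝ}, Measurable f →
      Q.map (fun ω => f (ω n)) = (P n).map f := by
    intro n f hf
    rw [← (measurePreserving_eval_infinitePi P n).map_eq,
      Measure.map_map hf (measurable_pi_apply n)]
    rfl
  have hX' : TendstoInDistribution (fun n (ω : (k : ℕ) → Ω k) => X n (ω n)) atTop Z
      (fun _ => Q) μ :=
    tendstoInDistribution_of_map_eq h
      (fun n => ((hX n).comp (measurable_pi_apply n)).aemeasurable) fun n => hmap (hX n)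
  have hY' : TendstoInDistribution (fun n (ω : (k : ℕ) → Ω k) => Y n (ω n)) atTop Z
      (fun _ => Q) μ := by
    refine tendstoInDistribution_of_tendstoInMeasure_sub _ Z hX' ?_
      (fun n => ((hY n).comp (measurable_pi_apply n)).aemeasurable)
    rw [tendstoInMeasure_iff_norm]
    intro η hη
    refine (hsub η hη).congr fun n => ?_
    have hs : MeasurableSet {ω : Ω n | η ≤ |Y n ω - X n ω|} :=
      measurableSet_le measurable_const (continuous_abs.measurable.comp ((hY n).sub (hX n)))
    have h1 := (measurePreserving_eval_infinitePi P n).measure_preimage hs.nullMeasurableSet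
    rw [← h1]
    congr 1
    ext ω
    simp
  exact tendstoInDistribution_of_map_eq hY' (fun n => (hY n).aemeasurable)
    fun n => (hmap (hY n)).symm

lemma integral_sq_eq {ν : Measure ℝ} {σ : ℝ} (hmean : ∫ e, e ∂ν = 0) (hvar : variance (fun e : ℝ => e) ν = σ ^ 2) :
    ∫ e, e ^ 2 ∂ν = σ ^ 2 := by
  rw [← hvar, variance_of_integral_eq_zero (by fun_prop) hmean]

/-! ### The central limit theorem for the squared errors -/

section CentralLimit

variable {Ω : ℕ → Type*} [∀ n, MeasurableSpace (Ω n)] {P : (n : ℕ) → Measure (Ω n)}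
  [∀ n, IsProbabilityMeasure (P n)] {p : ℕ → ℕ}
  {x : (n : ℕ) → Fin n → Ω n → Fin (p n) → ℝ} {ε : (n : ℕ) → Fin n → Ω n → ℝ}
  {ν : Measure ℝ} [IsProbabilityMeasure ν] {σ : ℝ}

/-- Since the error law is the same for all `n`, row `n` of the array has the law of the first `n`
terms of one i.i.d. sequence, to which the classical theorem applies. -/
lemma tendstoInDistribution_sum_sq_error (h : ErrorCondition P x ε ν σ)
    (h4 : Integrable (fun e : ℝ => e ^ 4) ν) :
    TendstoInDistribution (fun (n : ℕ) (ω : Ω n) => (√(n : ℝ))⁻¹ * (∑ i, ε n i ω ^ 2 - n * σ ^ 2)) atTop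
      (fun z : ℝ => z) P
      (gaussianReal 0 (Real.toNNReal (∫ e, e ^ 4 ∂ν - σ ^ 4))) := by
  set Q := Measure.infinitePi (fun _ : ℕ => ν) with hQ
  have hev : ∀ k, MeasurePreserving (fun e : ℕ → ℝ => e k) Q ν :=
    fun k => measurePreserving_eval_infinitePi (fun _ : ℕ => ν) k
  have hL2 : MemLp (fun e : ℝ => e ^ 2) 2 ν := by
    rw [memLp_two_iff_integrable_sq (by fun_prop)]
    simpa [← pow_mul] using h4
  have hident : ∀ k, IdentDistrib (fun e : ℕ → ℝ => e k ^ 2) (fun e : ℝ => e ^ 2) Q ν := fun k =>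
    ⟨((measurable_pi_apply k).pow_const 2).aemeasurable, by fun_prop, by
      rw [← (hev k).map_eq, Measure.map_map (by fun_prop) (by fun_prop)]
      rfl⟩
  have hmean : ∫ e, e 0 ^ 2 ∂Q = σ ^ 2 :=
    (hident 0).integral_eq.trans (integral_sq_eq h.mean_zero h.variance_eq)
  have hvar : variance (fun e : ℕ → ℝ => e 0 ^ 2) Q = ∫ e, e ^ 4 ∂ν - σ ^ 4 := by
    rw [(hident 0).variance_eq, variance_eq_sub hL2]
    simp only [Pi.pow_apply, integral_sq_eq h.mean_zero h.variance_eq, ← pow_mul]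
  have hind : iIndepFun (fun (k : ℕ) (e : ℕ → ℝ) => e k) Q :=
    iIndepFun_infinitePi (X := fun _ e => e) fun _ => measurable_id
  have hclt := tendstoInDistribution_inv_sqrt_mul_sum_sub
    (P' := gaussianReal 0 (Real.toNNReal (∫ e, e ^ 4 ∂ν - σ ^ 4))) (Y := fun z : ℝ => z)
    (X := fun k (e : ℕ → ℝ) => e k ^ 2) (P := Q)
    ⟨by fun_prop, by rw [hvar]; exact Measure.map_id⟩
    ((hident 0).symm.memLp_iff.1 hL2)
    (hind.comp (fun _ e => e ^ 2) fun _ => by fun_prop)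
    (fun k => (hident k).trans (hident 0).symm)
  have hmε : ∀ n i, Measurable (ε n i) := h.measurable_error
  refine tendstoInDistribution_of_map_eq hclt (fun n => ?_) fun n => ?_
  · have := hmε n
    fun_prop
  · set w : (Fin n → ℝ) → ℝ := fun e => (√(n : ℝ))⁻¹ * (∑ i, e i ^ 2 - n * σ ^ 2) with hw
    have hwm : Measurable w := by fun_prop
    have h1 : (P n).map (fun ω => (√(n : ℝ))⁻¹ * (∑ i, ε n i ω ^ 2 - n * σ ^ 2)) =
        (Measure.pi fun _ : Fin n => ν).map w := by
      rw [← h.map_error n,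
        Measure.map_map hwm (measurable_pi_lambda _ fun i => hmε n i)]
      rfl
    have h2 : Q.map (fun e (i : Fin n) => e i) = Measure.pi fun _ : Fin n => ν := by
      have h3 := (iIndepFun_iff_map_fun_eq_pi_map
        (f := fun (i : Fin n) (e : ℕ → ℝ) => e i) fun i => (measurable_pi_apply _).aemeasurable).1
        (hind.precomp Fin.val_injective)
      rw [h3]
      congr 1
      ext1 i
      exact (hev i).map_eq
    rw [h1, ← h2, Measure.map_map hwm (by fun_prop)]
    congr 1
    ext e
    simp only [hmean, Finset.sum_range, hw, Function.comp_def]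

end CentralLimit

/-! ### Asymptotic orders -/

section Asymptotics

variable {α₀ : ℝ} {s : ℕ → ℕ} {lam : ℕ → ℝ} {S c : ℝ}

lemma tendsto_log_natCast : Tendsto (fun n : ℕ => Real.log n) atTop atTop :=
  Real.tendsto_log_atTop.comp tendsto_natCast_atTop_atTop

lemma tendsto_natCast_ratio (hα₀' : α₀ < 1)
    (hs : ∀ᶠ n : ℕ in atTop, (s n : ℝ) ≤ S * (n : ℝ) ^ α₀) :
    Tendsto (fun n : ℕ => (s n : ℝ) / n) atTop (𝓝 0) := by
  have h1 : Tendsto (fun n : ℕ => S * (n : ℝ) ^ (-(1 - α₀))) atTop (𝓝 0) := by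
    have := ((tendsto_rpow_neg_atTop (y := 1 - α₀) (by linarith)).comp
      tendsto_natCast_atTop_atTop).const_mul S
    simpa using this
  refine squeeze_zero' (Eventually.of_forall fun n => by positivity) ?_ h1
  filter_upwards [hs, eventually_gt_atTop 0] with n hn hpos
  have hn' : (0 : ℝ) < n := by exact_mod_cast hpos
  rw [div_le_iff₀ hn', mul_assoc]
  have : (n : ℝ) ^ (-(1 - α₀)) * n = (n : ℝ) ^ α₀ := by
    nth_rw 2 [← Real.rpow_one (n : ℝ)]
    rw [← Real.rpow_add hn']
    congr 1
    ring
  rwa [this]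

lemma mul_sq_level {n : ℕ} (hn : 0 < n) :
    (n : ℝ) * ((n : ℝ) ^ (-((1 - α₀) / 2)) * Real.log n) ^ 2 =
      (n : ℝ) ^ α₀ * Real.log n ^ 2 := by
  have hn' : (0 : ℝ) < n := by exact_mod_cast hn
  have h1 : (n : ℝ) * ((n : ℝ) ^ (-((1 - α₀) / 2))) ^ 2 = (n : ℝ) ^ α₀ := by
    rw [← Real.rpow_natCast, ← Real.rpow_mul hn'.le]
    nth_rw 1 [← Real.rpow_one (n : ℝ)]
    rw [← Real.rpow_add hn']
    congr 1
    push_cast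
    ring
  rw [mul_pow, ← mul_assoc, h1]

/-- By `mul_sq_level` the right side carries `(log n) ^ 2` and the left at most one logarithm, so
any constants are eventually beaten. -/
lemma eventually_form_le_level (hc : 0 < c) (hS : 0 < S)
    (hs : ∀ᶠ n : ℕ in atTop, (s n : ℝ) ≤ S * (n : ℝ) ^ α₀)
    (hlam : ∀ᶠ n : ℕ in atTop, c * ((n : ℝ) ^ (-((1 - α₀) / 2)) * Real.log n) ≤ lam n)
    {v κ : ℝ} (hv : 0 ≤ v) (hκ : 0 < κ) :
    ∀ᶠ n : ℕ in atTop, v * s n + (n : ℝ) ^ α₀ * Real.log n ≤ κ * n * lam n ^ 2 := by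
  have hlog := tendsto_log_natCast.eventually_ge_atTop (max 1 ((v * S + 1) / (κ * c ^ 2)))
  filter_upwards [hs, hlam, hlog, eventually_gt_atTop 0] with n h1 h2 h3 hpos
  have hn' : (0 : ℝ) < n := by exact_mod_cast hpos
  set l := Real.log n with hl
  have hl1 : 1 ≤ l := (le_max_left _ _).trans h3
  have hl2 : v * S + 1 ≤ κ * c ^ 2 * l := by
    have := (le_max_right _ _).trans h3
    rw [div_le_iff₀ (by positivity)] at this
    linarith
  set R := (n : ℝ) ^ α₀ with hR
  have hRpos : 0 < R := Real.rpow_pos_of_pos hn' _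
  have hv1 : v * s n ≤ v * (S * R) := by gcongr
  have hvS : 0 ≤ v * S := by positivity
  have h4 : v * S + l ≤ κ * c ^ 2 * l ^ 2 := by nlinarith
  have h5 : (c * ((n : ℝ) ^ (-((1 - α₀) / 2)) * l)) ^ 2 ≤ lam n ^ 2 := by gcongr
  calc v * s n + R * l ≤ R * (v * S + l) := by linarith
    _ ≤ R * (κ * c ^ 2 * l ^ 2) := by gcongr
    _ = κ * c ^ 2 * (R * l ^ 2) := by ring
    _ = κ * n * (c * ((n : ℝ) ^ (-((1 - α₀) / 2)) * l)) ^ 2 := by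
        rw [← mul_sq_level (α₀ := α₀) hpos]; ring
    _ ≤ _ := by gcongr

lemma tendsto_form_deviation (hα₀ : 0 ≤ α₀)
    (hs : ∀ᶠ n : ℕ in atTop, (s n : ℝ) ≤ S * (n : ℝ) ^ α₀) {K : ℝ} (hK : 0 ≤ K) :
    Tendsto (fun n : ℕ => K * s n / ((n : ℝ) ^ α₀ * Real.log n) ^ 2) atTop (𝓝 0) := by
  have h1 : Tendsto (fun n : ℕ => K * S / Real.log n) atTop (𝓝 0) :=
    tendsto_log_natCast.const_div_atTop _
  refine squeeze_zero' (Eventually.of_forall fun n => by positivity) ?_ h1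
  filter_upwards [hs, tendsto_log_natCast.eventually_ge_atTop 1, eventually_ge_atTop 1]
    with n h1 h2 h3
  have hn' : (1 : ℝ) ≤ n := by exact_mod_cast h3
  have hR : 1 ≤ (n : ℝ) ^ α₀ := Real.one_le_rpow hn' hα₀
  set R := (n : ℝ) ^ α₀
  set l := Real.log n
  have hS : 0 ≤ S := by
    by_contra h
    have : (0 : ℝ) ≤ s n := by positivity
    nlinarith
  calc K * s n / (R * l) ^ 2 ≤ K * (S * R) / (R * l) ^ 2 := by gcongr
    _ = K * S / (R * l ^ 2) := by field_simp
    _ ≤ K * S / l := by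
        have : l ≤ R * l ^ 2 := by nlinarith
        gcongr

/-- The Chernoff parameter `t₀ * n ^ (-(1 - α₀) / 2)` makes the quadratic term of order `n ^ α₀`,
like `log p`, while the linear gain is at least of order `n ^ α₀ * log n`. -/
lemma tendsto_union_bound {p : ℕ → ℕ} (hα₀ : 0 ≤ α₀) (hc : 0 < c)
    (hlam : ∀ᶠ n : ℕ in atTop, c * ((n : ℝ) ^ (-((1 - α₀) / 2)) * Real.log n) ≤ lam n)
    {D K t₀ : ℝ} (hp : ∀ᶠ n : ℕ in atTop, Real.log (p n) ≤ D * (n : ℝ) ^ α₀) (ht₀ : 0 < t₀) :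
    Tendsto (fun n : ℕ => p n * (2 * Real.exp (n * (K * (t₀ * (n : ℝ) ^ (-((1 - α₀) / 2))) ^ 2) -
      t₀ * (n : ℝ) ^ (-((1 - α₀) / 2)) * (n * lam n / 2)))) atTop (𝓝 0) := by
  have h0 : Tendsto (fun n : ℕ => D + K * t₀ ^ 2 - t₀ * c / 2 * Real.log n) atTop atBot := by
    have := tendsto_log_natCast.const_mul_atTop (r := t₀ * c / 2) (by positivity)
    simpa [sub_eq_add_neg] using
      tendsto_atBot_add_const_left atTop (D + K * t₀ ^ 2) (tendsto_neg_atTop_atBot.comp this)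
  have h1 : Tendsto (fun n : ℕ => 2 * Real.exp (D + K * t₀ ^ 2 - t₀ * c / 2 * Real.log n))
      atTop (𝓝 0) := by
    simpa using (Real.tendsto_exp_atBot.comp h0).const_mul 2
  refine squeeze_zero' (Eventually.of_forall fun n => by positivity) ?_ h1
  filter_upwards [hlam, hp, h0.eventually_le_atBot 0, eventually_ge_atTop 1] with n h2 h3 h4 hn1
  have hn' : (1 : ℝ) ≤ n := by exact_mod_cast hn1
  have hn0 : (0 : ℝ) < n := by linarith
  have hR : 1 ≤ (n : ℝ) ^ α₀ := Real.one_le_rpow hn' hα₀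
  set R := (n : ℝ) ^ α₀ with hRdef
  set l := Real.log n with hl
  set w := (n : ℝ) ^ (-((1 - α₀) / 2)) with hw
  have hw0 : 0 < w := Real.rpow_pos_of_pos hn0 _
  have hwR : n * w ^ 2 = R := by
    rw [hw, hRdef, ← Real.rpow_natCast, ← Real.rpow_mul hn0.le]
    nth_rw 1 [← Real.rpow_one (n : ℝ)]
    rw [← Real.rpow_add hn0]
    congr 1
    push_cast
    ring
  have hpe : (p n : ℝ) ≤ Real.exp (D * R) := by
    rcases Nat.eq_zero_or_pos (p n) with h | h
    · rw [h]
      simpa using (Real.exp_pos _).le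
    · rw [← Real.log_le_iff_le_exp (by exact_mod_cast h)]
      exact h3
  have hexp : n * (K * (t₀ * w) ^ 2) - t₀ * w * (n * lam n / 2) ≤
      R * (K * t₀ ^ 2 - t₀ * c / 2 * l) := by
    have e1 : n * (K * (t₀ * w) ^ 2) = R * (K * t₀ ^ 2) := by rw [← hwR]; ring
    have e2 : t₀ * w * (n * (c * (w * l)) / 2) = R * (t₀ * c / 2 * l) := by rw [← hwR]; ring
    have e3 : t₀ * w * (n * (c * (w * l)) / 2) ≤ t₀ * w * (n * lam n / 2) := by gcongr
    rw [e1, mul_sub, ← e2]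
    linarith
  calc _ ≤ Real.exp (D * R) * (2 * Real.exp (R * (K * t₀ ^ 2 - t₀ * c / 2 * l))) := by gcongr
    _ = 2 * Real.exp (R * (D + K * t₀ ^ 2 - t₀ * c / 2 * l)) := by
        rw [mul_left_comm, ← Real.exp_add]
        ring_nf
    -- The bracket is eventually nonpositive, so dropping the factor `R ≥ 1` only increases the
    -- exponent.
    _ ≤ _ := by
        gcongr
        nlinarith

lemma tendsto_remainder_bound (hr : Tendsto (fun n : ℕ => (s n : ℝ) / n) atTop (𝓝 0)) (K : ℝ) :
    Tendsto (fun n : ℕ => K * (2 * ((s n : ℝ) ^ 2 + n * s n) / (n - s n) ^ 2)) atTop (𝓝 0) := by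
  have h1 : Tendsto (fun n : ℕ => K * (2 * (((s n : ℝ) / n) ^ 2 + (s n : ℝ) / n) /
      (1 - (s n : ℝ) / n) ^ 2)) atTop (𝓝 (K * (2 * (0 ^ 2 + 0) / (1 - 0) ^ 2))) :=
    ((((hr.pow 2).add hr).const_mul 2).div ((tendsto_const_nhds.sub hr).pow 2)
      (by norm_num)).const_mul K
  simp only [ne_eq, OfNat.ofNat_ne_zero, not_false_eq_true, zero_pow, add_zero, mul_zero,
    zero_div] at h1
  refine h1.congr' ?_
  filter_upwards [eventually_gt_atTop 0] with n hn
  have hn' : (n : ℝ) ≠ 0 := by exact_mod_cast hn.ne'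
  congr 1
  have e1 : 1 - (s n : ℝ) / n = (n - s n) / n := by field_simp
  rw [e1, div_pow]
  -- If `s n = n`, both sides are `0` by the convention for division by zero.
  by_cases h : (n : ℝ) - s n = 0
  · simp [h]
  · field_simp

end Asymptotics

/-! ### The variance error as a centred quadratic form -/

lemma centredForm_eq {m : Type*} [Fintype m] [DecidableEq m] (v : ℝ) (H : Matrix m m ℝ)
    (e : m → ℝ) : centredForm v H e = e ⬝ᵥ (H *ᵥ e) - v * H.trace := by
  have h1 : ∑ q : m × m, H q.1 q.2 * (e q.1 * e q.2) = e ⬝ᵥ (H *ᵥ e) := by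
    rw [Fintype.sum_prod_type]
    simp only [dotProduct, Matrix.mulVec, Finset.mul_sum]
    exact Finset.sum_congr rfl fun i _ => Finset.sum_congr rfl fun j _ => by ring
  have h2 : ∑ q : m × m, H q.1 q.2 * (if q.1 = q.2 then v else 0) = v * H.trace := by
    rw [Fintype.sum_prod_type]
    simp [Matrix.trace, Finset.mul_sum, mul_comm]
  unfold centredForm centredProd
  simp only [mul_sub, Finset.sum_sub_distrib]
  rw [h1, h2]

/-- The matrix of the quadratic form by which the normalized estimation error of the oracle
variance estimator differs from the normalized sum of the centred squared errors. -/
noncomputable def remainderMatrix {n : ℕ} (s : ℕ) (H : Matrix (Fin n) (Fin n) ℝ) :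
    Matrix (Fin n) (Fin n) ℝ :=
  ((s : ℝ) / (√n * (n - s))) • (1 : Matrix (Fin n) (Fin n) ℝ) - (√n / (n - s)) • H

lemma sum_sq_remainderMatrix_le {n s : ℕ} (hn : 0 < n) {H : Matrix (Fin n) (Fin n) ℝ}
    (hH : ∑ i, ∑ j, H i j ^ 2 ≤ s) :
    ∑ i, ∑ j, remainderMatrix s H i j ^ 2 ≤ 2 * ((s : ℝ) ^ 2 + n * s) / (n - s) ^ 2 := by
  have hn' : (0 : ℝ) < n := by exact_mod_cast hn
  set c₁ := (s : ℝ) / (√n * (n - s)) with hc₁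
  set c₂ := √n / ((n : ℝ) - s) with hc₂
  have h1 : ∀ i j, remainderMatrix s H i j ^ 2 ≤
      2 * c₁ ^ 2 * (if i = j then 1 else 0) + 2 * c₂ ^ 2 * H i j ^ 2 := by
    intro i j
    simp only [remainderMatrix, Matrix.sub_apply, Matrix.smul_apply, smul_eq_mul, Matrix.one_apply]
    split_ifs
    · nlinarith [sq_nonneg (c₁ * 1 + c₂ * H i j)]
    · nlinarith [sq_nonneg (c₂ * H i j)]
  have e1 : c₁ ^ 2 * n = (s : ℝ) ^ 2 / (n - s) ^ 2 := by
    rw [hc₁, div_pow, mul_pow, Real.sq_sqrt hn'.le]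
    field_simp
  have e2 : c₂ ^ 2 = n / ((n : ℝ) - s) ^ 2 := by
    rw [hc₂, div_pow, Real.sq_sqrt hn'.le]
  calc _ ≤ ∑ i : Fin n, ∑ j : Fin n,
        (2 * c₁ ^ 2 * (if i = j then 1 else 0) + 2 * c₂ ^ 2 * H i j ^ 2) :=
        Finset.sum_le_sum fun i _ => Finset.sum_le_sum fun j _ => h1 i j
    _ = 2 * (c₁ ^ 2 * n) + 2 * c₂ ^ 2 * ∑ i, ∑ j, H i j ^ 2 := by
        simp only [Finset.sum_add_distrib, ← Finset.mul_sum, Finset.sum_ite_eq, Finset.mem_univ,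
          if_true, Finset.sum_const, Finset.card_univ, Fintype.card_fin, nsmul_eq_mul, mul_one]
        ring
    _ ≤ 2 * (c₁ ^ 2 * n) + 2 * c₂ ^ 2 * s := by gcongr
    _ = _ := by rw [e1, e2]; ring

/-- The remainder matrix has trace zero when `tr H = s`, so no bias term survives: the divisor `n -
s` compensates exactly for `E (eᵀ H e) = s * v`. -/
lemma oracle_error_sub_eq {n s : ℕ} (hn : 0 < n) (hs : s < n) {H : Matrix (Fin n) (Fin n) ℝ}
    (hH : H.trace = s) (v : ℝ) (e : Fin n → ℝ) :
    √(n : ℝ) * ((∑ i, e i ^ 2 - e ⬝ᵥ (H *ᵥ e)) / (n - s) - v) -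
      (√(n : ℝ))⁻¹ * (∑ i, e i ^ 2 - n * v) = centredForm v (remainderMatrix s H) e := by
  have hn' : (0 : ℝ) < n := by exact_mod_cast hn
  have hs' : (0 : ℝ) < n - s := sub_pos.2 (by exact_mod_cast hs)
  have hsq : √(n : ℝ) * √n = n := Real.mul_self_sqrt hn'.le
  have hpos : 0 < √(n : ℝ) := Real.sqrt_pos.2 hn'
  rw [centredForm_eq, remainderMatrix, Matrix.sub_mulVec, Matrix.smul_mulVec, Matrix.smul_mulVec,
    Matrix.one_mulVec, dotProduct_sub, dotProduct_smul, dotProduct_smul, Matrix.trace_sub,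
    Matrix.trace_smul, Matrix.trace_smul, Matrix.trace_one, hH, Fintype.card_fin]
  have h1 : e ⬝ᵥ e = ∑ i, e i ^ 2 := by simp [dotProduct, sq]
  rw [h1]
  simp only [smul_eq_mul]
  generalize √(n : ℝ) = r at *
  generalize e ⬝ᵥ (H *ᵥ e) = q
  generalize ∑ i, e i ^ 2 = E
  have hne : r ^ 2 - s ≠ 0 := by rw [sq, hsq]; exact hs'.ne'
  rw [← hsq, ← sq]
  field_simp
  ring

/-! ### Probability estimates for the oracle -/

section Model

variable {Ω : ℕ → Type*} [∀ n, MeasurableSpace (Ω n)] {P : (n : ℕ) → Measure (Ω n)}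
  {p : ℕ → ℕ} {x : (n : ℕ) → Fin n → Ω n → Fin (p n) → ℝ} {ε : (n : ℕ) → Fin n → Ω n → ℝ}
  {β : (n : ℕ) → Fin (p n) → ℝ} {ν : Measure ℝ} {σ : ℝ}

lemma le_of_ofReal_le_halfMinSignal {q : ℕ} {b : Fin q → ℝ} {r : ℝ}
    (h : ENNReal.ofReal r ≤ halfMinSignal b) {j : Fin q} (hj : j ∈ model b) : r ≤ |b j| / 2 :=
  (ENNReal.ofReal_le_ofReal_iff (by positivity)).1 (h.trans (iInf₂_le j hj))

open Classical in
/-- The projection onto the span of the relevant columns. -/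
noncomputable def oracleHat {n q : ℕ} (b : Fin q → ℝ) (X : Matrix (Fin n) (Fin q) ℝ) :
    Matrix (Fin n) (Fin n) ℝ :=
  hatMatrix (columns X (model b))

lemma card_model {q : ℕ} (b : Fin q → ℝ) [Fintype (model b)] :
    Fintype.card (model b) = (model b).ncard := by
  rw [← Nat.card_eq_fintype_card, Nat.card_coe_set_eq]

lemma sum_sq_oracleHat {n q : ℕ} (b : Fin q → ℝ) (X : Matrix (Fin n) (Fin q) ℝ) :
    ∑ i, ∑ j, oracleHat b X i j ^ 2 = (oracleHat b X).trace  := by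
  classical
  exact sum_sq_hatMatrix _

lemma trace_oracleHat_le {n q : ℕ} (b : Fin q → ℝ) (X : Matrix (Fin n) (Fin q) ℝ) :
    (oracleHat b X).trace ≤ (model b).ncard := by
  classical
  rw [← card_model]
  exact trace_hatMatrix_le _

lemma measurable_oracleHat_entry {n q : ℕ} (b : Fin q → ℝ) (i j : Fin n) :
    Measurable fun X : Fin n → Fin q → ℝ => oracleHat b (Matrix.of X) i j := by
  classical
  exact measurable_hatMatrix_entry
    (fun i k => (measurable_pi_apply k.1).comp (measurable_pi_apply i)) i j

lemma WithProbTendingToOne.mono {E F : (n : ℕ) → Set (Ω n)} (h : WithProbTendingToOne P E)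
    (hEF : ∀ n, E n ⊆ F n) : WithProbTendingToOne P F :=
  tendsto_of_tendsto_of_tendsto_of_le_of_le tendsto_const_nhds h (fun _ => zero_le)
    fun n => measure_mono (Set.compl_subset_compl.2 (hEF n))

lemma measurable_plugInVariance_oracle (herr : ErrorCondition P x ε ν σ) (n : ℕ) :
    Measurable fun ω => plugInVariance (design x n ω) (response x ε β n ω)
      (oracleEstimator (model (β n)) (design x n ω, response x ε β n ω)) := by
  have hX : ∀ i j, Measurable fun ω => design x n ω i j := fun i j =>
    (measurable_pi_apply j).comp (herr.measurable_design n i)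
  have hy : ∀ i, Measurable fun ω => response x ε β n ω i := fun i =>
    (measurable_mulVec_entry (v := fun _ => β n) hX (fun _ => measurable_const) i).add (herr.measurable_error n i)
  refine measurable_plugInVariance hX hy fun j => ?_
  have hz : Measurable fun ω => ((fun i => x n i ω, response x ε β n ω) :
      (Fin n → Fin (p n) → ℝ) × (Fin n → ℝ)) :=
    (measurable_pi_lambda _ fun i => herr.measurable_design n i).prodMk
      (measurable_pi_lambda _ hy)
  exact (measurable_pi_apply j).comp ((measurable_oracleEstimator (model (β n))).comp hz)

variable [∀ n, IsProbabilityMeasure (P n)] [IsProbabilityMeasure ν]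

lemma measure_le_abs_centredForm_design_le (h : ErrorCondition P x ε ν σ)
    (h4 : Integrable (fun e : ℝ => e ^ 4) ν) (n : ℕ)
    {H : (Fin n → Fin (p n) → ℝ) → Matrix (Fin n) (Fin n) ℝ}
    (hH : ∀ i j, Measurable fun X => H X i j) {C : ℝ}
    (hC : ∀ X, ∑ i, ∑ j, H X i j ^ 2 ≤ C) {τ : ℝ} (hτ : 0 < τ) :
    P n {ω | τ ≤ |centredForm (σ ^ 2) (H (fun i => x n i ω)) (fun i => ε n i ω)|} ≤
      ENNReal.ofReal (2 * (∫ e, e ^ 4 ∂ν + (σ ^ 2) ^ 2) * C / τ ^ 2) := by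
  refine measure_le_abs_centredForm_le h.mean_zero (sq_nonneg σ) ?_ h4
    (measurable_pi_lambda _ fun i => h.measurable_design n i)
    (measurable_pi_lambda _ fun i => h.measurable_error n i)
    (h.indep_design n) (h.map_error n) hH hC hτ
  rw [integral_sub h.square_integrable.integrable_sq (integrable_const _),
    integral_sq_eq h.mean_zero h.variance_eq]
  simp

open Classical in
/-- With probability tending to one, the relevant columns are linearly independent and the oracle
estimator is a strict local minimizer with the right support. -/
lemma withProbTendingToOne_oracle {a : ℝ} (ha : 2 < a) {lam : ℕ → ℝ} {α₀ : ℝ} (hα₀ : 0 ≤ α₀)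
    (hp : (fun n => Real.log (p n)) =O[atTop] (fun n : ℕ => (n : ℝ) ^ α₀))
    (hs : (fun n => ((model (β n)).ncard : ℝ)) =O[atTop] (fun n : ℕ => (n : ℝ) ^ α₀))
    (herr : ErrorCondition P x ε ν σ) (h4 : Integrable (fun e : ℝ => e ^ 4) ν)
    (hmgf : ∃ K t₀ : ℝ, 0 < K ∧ 0 < t₀ ∧ ∀ n j t, |t| ≤ t₀ →
      ∫⁻ ω, ENNReal.ofReal (Real.exp (t * ∑ i, x n i ω j * ε n i ω)) ∂(P n) ≤
        ENNReal.ofReal (Real.exp (n * (K * t ^ 2))))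
    (hdesign : DesignCondition P x β) (htuning : SignalTuningCondition β lam α₀)
    (hα₀' : α₀ < 1) :
    WithProbTendingToOne P (fun n => {ω |
      (IsStrictLocalMin (objective a (lam n) (design x n ω) (response x ε β n ω))
        (oracleEstimator (model (β n)) (design x n ω, response x ε β n ω)) ∧
      model (oracleEstimator (model (β n)) (design x n ω, response x ε β n ω)) = model (β n)) ∧
      IsUnit ((columns (design x n ω) (model (β n)))ᵀ *
        columns (design x n ω) (model (β n))).det}) := by
  obtain ⟨c₁, c₂, hc₁, hc₂, hD1, hD2⟩ := hdesign
  obtain ⟨-, ⟨c, C, hc, -, hlam'⟩, hsig⟩ := htuning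
  have hlam : ∀ᶠ n : ℕ in atTop,
      c * ((n : ℝ) ^ (-((1 - α₀) / 2)) * Real.log n) ≤ lam n := hlam'.mono fun n h => h.1
  obtain ⟨S, hS, hs'⟩ := hs.exists_pos
  obtain ⟨D, -, hp'⟩ := hp.exists_pos
  have hs : ∀ᶠ n : ℕ in atTop, ((model (β n)).ncard : ℝ) ≤ S * (n : ℝ) ^ α₀ := by
    filter_upwards [hs'.bound] with n hn
    rwa [Real.norm_of_nonneg (by positivity), Real.norm_of_nonneg (by positivity)] at hn
  have hp : ∀ᶠ n : ℕ in atTop, Real.log (p n) ≤ D * (n : ℝ) ^ α₀ := by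
    filter_upwards [hp'.bound] with n hn
    rw [Real.norm_of_nonneg (by positivity : 0 ≤ (n : ℝ) ^ α₀)] at hn
    exact (Real.le_norm_self _).trans hn
  obtain ⟨K, t₀, hK, ht₀, hmgf⟩ := hmgf
  set K₄ := 2 * (∫ e, e ^ 4 ∂ν + (σ ^ 2) ^ 2) with hK₄
  have hK₄0 : 0 ≤ K₄ :=
    mul_nonneg two_pos.le (add_nonneg (integral_nonneg fun x => by positivity) (by positivity))
  set w : ℕ → ℝ := fun n => (n : ℝ) ^ (-((1 - α₀) / 2)) with hw
  set τ : ℕ → ℝ := fun n => (n : ℝ) ^ α₀ * Real.log n with hτ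
  set E₁ : (n : ℕ) → Set (Ω n) := fun n => {ω | (c₁ : EReal) ≤ lambdaMin ((n : ℝ)⁻¹ •
        ((columns (design x n ω) (model (β n)))ᵀ * columns (design x n ω) (model (β n))))} with hE₁
  set E₂ : (n : ℕ) → Set (Ω n) := fun n => {ω | normTwoInfty ((n : ℝ)⁻¹ •
        ((columns (design x n ω) (model (β n))ᶜ)ᵀ * columns (design x n ω) (model (β n))))
          ≤ ENNReal.ofReal c₂} with hE₂
  set F₁ : (n : ℕ) → Set (Ω n) := fun n => {ω | τ n ≤ |centredForm (σ ^ 2)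
    (oracleHat (β n) (Matrix.of fun i => x n i ω)) (fun i => ε n i ω)|} with hF₁
  set F₂ : (n : ℕ) → Set (Ω n) := fun n =>
    {ω | ¬ ∀ j, |∑ i, x n i ω j * ε n i ω| ≤ n * lam n / 2} with hF₂
  have hF₁lim : Tendsto (fun n => P n (F₁ n)) atTop (𝓝 0) := by
    have h1 := ENNReal.tendsto_ofReal (tendsto_form_deviation hα₀ hs hK₄0)
    rw [ENNReal.ofReal_zero] at h1
    refine tendsto_of_tendsto_of_tendsto_of_le_of_le' tendsto_const_nhds h1
      (Eventually.of_forall fun n => zero_le) ?_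
    filter_upwards [tendsto_log_natCast.eventually_gt_atTop 0, eventually_gt_atTop 0]
      with n hn hn0
    have hτ0 : 0 < τ n := mul_pos (Real.rpow_pos_of_pos (by exact_mod_cast hn0) _) hn
    exact measure_le_abs_centredForm_design_le herr h4 n
      (H := fun X => oracleHat (β n) (Matrix.of X)) (measurable_oracleHat_entry (β n))
      (fun X => (sum_sq_oracleHat _ _).trans_le (trace_oracleHat_le _ _)) hτ0
  have hF₂lim : Tendsto (fun n => P n (F₂ n)) atTop (𝓝 0) := by
    have h1 := ENNReal.tendsto_ofReal (tendsto_union_bound (K := K) hα₀ hc hlam hp ht₀)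
    rw [ENNReal.ofReal_zero] at h1
    refine tendsto_of_tendsto_of_tendsto_of_le_of_le' tendsto_const_nhds h1
      (Eventually.of_forall fun n => zero_le) ?_
    filter_upwards [eventually_ge_atTop 1] with n hn
    have hn' : (1 : ℝ) ≤ n := by exact_mod_cast hn
    have hw1 : w n ≤ 1 := Real.rpow_le_one_of_one_le_of_nonpos hn' (by linarith)
    have hw0 : 0 < w n := Real.rpow_pos_of_pos (by linarith) _
    exact measure_lt_abs_sum_le herr hmgf n (mul_pos ht₀ hw0) (by nlinarith)
  have hlim : Tendsto (fun n => P n (E₁ n)ᶜ + P n (E₂ n)ᶜ + P n (F₁ n) + P n (F₂ n)) atTop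
      (𝓝 0) := by
    simpa using ((Tendsto.add hD1 hD2).add hF₁lim).add hF₂lim
  -- One level serves both quadratic form bounds required by `oracle_isStrictLocalMin`.
  set κ := min 1 ((1 / (4 * c₂)) ^ 2) with hκ
  have hκ0 : 0 < κ := lt_min one_pos (by positivity)
  have hlev := eventually_form_le_level hc hS hs hlam (sq_nonneg σ)
    (mul_pos hc₁ hκ0)
  refine tendsto_of_tendsto_of_tendsto_of_le_of_le' tendsto_const_nhds hlim
    (Eventually.of_forall fun n => zero_le) ?_
  filter_upwards [hlev, hsig a (by linarith), hlam, eventually_gt_atTop 0,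
    tendsto_log_natCast.eventually_gt_atTop 0] with n hlevn hsign hlamn hn0 hlogn
  have hn' : (0 : ℝ) < n := by exact_mod_cast hn0
  have hl : 0 < lam n :=
    lt_of_lt_of_le (mul_pos hc (mul_pos (Real.rpow_pos_of_pos hn' _) hlogn)) hlamn
  have hsub : ∀ A B C D : Set (Ω n), P n (A ∪ B ∪ C ∪ D) ≤ P n A + P n B + P n C + P n D :=
    fun A B C D => (measure_union_le _ _).trans
      (add_le_add_left ((measure_union_le _ _).trans
        (add_le_add_left (measure_union_le _ _) _)) _)
  -- The bad event is only covered by four others, so its own measurability never matters.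
  refine (measure_mono ?_).trans (hsub (E₁ n)ᶜ (E₂ n)ᶜ (F₁ n) (F₂ n))
  intro ω hω
  by_contra hnot
  simp only [Set.mem_union, not_or, Set.mem_compl_iff, not_not] at hnot
  obtain ⟨⟨⟨h1, h2⟩, h3⟩, h5⟩ := hnot
  refine hω ?_
  have h5' : ∀ j, |∑ i, x n i ω j * ε n i ω| ≤ n * lam n / 2 := not_not.1 h5
  have h3' : |centredForm (σ ^ 2) (oracleHat (β n) (design x n ω)) (fun i => ε n i ω)| < τ n :=
    not_le.1 h3
  rw [centredForm_eq] at h3'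
  have hq : (fun i => ε n i ω) ⬝ᵥ (oracleHat (β n) (design x n ω) *ᵥ fun i => ε n i ω) ≤
      c₁ * κ * n * lam n ^ 2 := by
    have h6 := (abs_lt.1 h3').2
    have h7 : σ ^ 2 * (oracleHat (β n) (design x n ω)).trace ≤
        σ ^ 2 * ((model (β n)).ncard : ℝ) :=
      mul_le_mul_of_nonneg_left (trace_oracleHat_le _ _) (sq_nonneg σ)
    linarith
  have hbase : 0 ≤ c₁ * n * lam n ^ 2 := by positivity
  refine ⟨oracle_isStrictLocalMin hn0 (by linarith) hl hc₁ hc₂ (design x n ω) (β n)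
    (fun i => ε n i ω) h1 h2 ?_ ?_ h5' (fun j hj => le_of_ofReal_le_halfMinSignal hsign hj),
    isUnit_det_of_le_lambdaMin hn0 hc₁ h1⟩
  · refine hq.trans ?_
    calc c₁ * κ * n * lam n ^ 2 = κ * (c₁ * n * lam n ^ 2) := by ring
      _ ≤ 1 * (c₁ * n * lam n ^ 2) := by gcongr; exact min_le_left _ _
      _ = _ := one_mul _
  · refine hq.trans ?_
    calc c₁ * κ * n * lam n ^ 2 = κ * (c₁ * n * lam n ^ 2) := by ring
      _ ≤ (1 / (4 * c₂)) ^ 2 * (c₁ * n * lam n ^ 2) := by gcongr; exact min_le_right _ _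
      _ = _ := by ring

-- Off an event of vanishing probability the difference from the central limit sum equals the
-- remainder form, which tends to zero in probability because `s / n` does.
open Classical in
lemma tendstoInDistribution_plugInVariance_oracle {α₀ : ℝ} (hα₀' : α₀ < 1)
    (hs : (fun n => ((model (β n)).ncard : ℝ)) =O[atTop] (fun n : ℕ => (n : ℝ) ^ α₀))
    (herr : ErrorCondition P x ε ν σ) (h4 : Integrable (fun e : ℝ => e ^ 4) ν)
    (hprob : WithProbTendingToOne P (fun n => {ω |
      model (oracleEstimator (model (β n)) (design x n ω, response x ε β n ω)) = model (β n) ∧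
      IsUnit ((columns (design x n ω) (model (β n)))ᵀ *
        columns (design x n ω) (model (β n))).det})) :
    TendstoInDistribution
      (fun (n : ℕ) (ω : Ω n) => √(n : ℝ) *
        (plugInVariance (design x n ω) (response x ε β n ω)
          (oracleEstimator (model (β n)) (design x n ω, response x ε β n ω)) - σ ^ 2))
      atTop (fun z : ℝ => z) P
      (gaussianReal 0 (Real.toNNReal (∫ e, e ^ 4 ∂ν - σ ^ 4))) := by
  obtain ⟨S, hS, hs'⟩ := hs.exists_pos
  have hs : ∀ᶠ n : ℕ in atTop, ((model (β n)).ncard : ℝ) ≤ S * (n : ℝ) ^ α₀ := by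
    filter_upwards [hs'.bound] with n hn
    rwa [Real.norm_of_nonneg (by positivity), Real.norm_of_nonneg (by positivity)] at hn
  have hratio := tendsto_natCast_ratio hα₀' hs
  have hW : ∀ n, Measurable fun ω : Ω n =>
      (√(n : ℝ))⁻¹ * (∑ i, ε n i ω ^ 2 - n * σ ^ 2) := fun n => by
    have := herr.measurable_error n
    fun_prop
  refine tendstoInDistribution_of_sub_tendsto_zero hW
    (fun n => measurable_const.mul ((measurable_plugInVariance_oracle herr n).sub_const _))
    (tendstoInDistribution_sum_sq_error herr h4) fun η hη => ?_
  set K₄ := 2 * (∫ e, e ^ 4 ∂ν + (σ ^ 2) ^ 2) with hK₄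
  have h1 := ENNReal.tendsto_ofReal (tendsto_remainder_bound hratio (K₄ / η ^ 2))
  rw [ENNReal.ofReal_zero] at h1
  have hlim := Tendsto.add hprob h1
  rw [add_zero] at hlim
  refine tendsto_of_tendsto_of_tendsto_of_le_of_le' tendsto_const_nhds hlim
    (Eventually.of_forall fun n => zero_le) ?_
  filter_upwards [eventually_gt_atTop 0, hratio.eventually_lt_const one_pos] with n hn0 hsn
  have hn' : (0 : ℝ) < n := by exact_mod_cast hn0
  have hsn' : (model (β n)).ncard < n := by
    rw [div_lt_one hn'] at hsn
    exact_mod_cast hsn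
  have h2 := measure_le_abs_centredForm_design_le herr h4 n
    (H := fun X => remainderMatrix (model (β n)).ncard (oracleHat (β n) (Matrix.of X)))
    (fun i j => measurable_const.sub ((measurable_oracleHat_entry (β n) i j).const_mul _))
    (fun X => sum_sq_remainderMatrix_le hn0
      ((sum_sq_oracleHat _ _).trans_le (trace_oracleHat_le _ _))) hη
  rw [mul_div_right_comm] at h2
  refine le_trans ?_ (add_le_add_right h2 _)
  refine le_trans (measure_mono ?_) (measure_union_le _ _)
  intro ω hω
  by_cases hgood : model (oracleEstimator (model (β n)) (design x n ω, response x ε β n ω)) =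
      model (β n) ∧ IsUnit ((columns (design x n ω) (model (β n)))ᵀ *
        columns (design x n ω) (model (β n))).det
  · right
    have e1 := plugInVariance_oracle (design x n ω) (β n) (fun i => ε n i ω) hgood.2 hgood.1
    have e2 := oracle_error_sub_eq hn0 hsn' (H := oracleHat (β n) (design x n ω))
      ((trace_hatMatrix hgood.2).trans (by rw [card_model])) (σ ^ 2) fun i => ε n i ω
    have e3 : plugInVariance (design x n ω) (response x ε β n ω)
        (oracleEstimator (model (β n)) (design x n ω, response x ε β n ω)) =
        (∑ i, ε n i ω ^ 2 - (fun i => ε n i ω) ⬝ᵥ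
          (oracleHat (β n) (design x n ω) *ᵥ fun i => ε n i ω)) /
          (n - (model (β n)).ncard) := e1
    have hω' : η ≤ |√(n : ℝ) * (plugInVariance (design x n ω) (response x ε β n ω)
        (oracleEstimator (model (β n)) (design x n ω, response x ε β n ω)) - σ ^ 2) -
        (√(n : ℝ))⁻¹ * (∑ i, ε n i ω ^ 2 - n * σ ^ 2)| := hω
    rw [e3, e2] at hω'
    exact hω'
  · left
    exact hgood

end Model

end SCAD

/-! ### The main theorem -/

theorem theorem4 {Ω : ℕ → Type*} [∀ n, MeasurableSpace (Ω n)]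
    (P : (n : ℕ) → Measure (Ω n)) [∀ n, IsProbabilityMeasure (P n)]
    (p : ℕ → ℕ)
    (x : (n : ℕ) → Fin n → Ω n → Fin (p n) → ℝ)
    (ε : (n : ℕ) → Fin n → Ω n → ℝ)
    (β : (n : ℕ) → Fin (p n) → ℝ)
    (ν : Measure ℝ) [IsProbabilityMeasure ν] (σ : ℝ)
    (a : ℝ) (ha : 2 < a) (lam : ℕ → ℝ)
    (α₀ : ℝ) (hα₀ : 0 ≤ α₀) (hα₀' : α₀ < 1)
    -- `log p` and the true model size are `O(n ^ α₀)`
    (hp : (fun n => Real.log (p n)) =O[atTop] (fun n : ℕ => (n : ℝ) ^ α₀))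
    (hs : (fun n => ((SCAD.model (β n)).ncard : ℝ)) =O[atTop] (fun n : ℕ => (n : ℝ) ^ α₀))
    (herr : SCAD.ErrorCondition P x ε ν σ)
    (htail : (SCAD.BoundedDesign P x ∧ SCAD.ErrorExpMoment ν 1) ∨
      (∃ α θ : ℝ, 1 < α ∧ 0 < θ ∧ 1 / α + 1 / θ ≤ 1 ∧
        SCAD.RandomDesign P x α ∧ SCAD.ErrorExpMoment ν θ))
    (hdesign : SCAD.DesignCondition P x β)
    (htuning : SCAD.SignalTuningCondition β lam α₀) :
    -- an estimator, as a measurable function of the design matrix and the response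
    ∃ βhat : (n : ℕ) → (Fin n → Fin (p n) → ℝ) × (Fin n → ℝ) → Fin (p n) → ℝ,
      (∀ n, Measurable (βhat n)) ∧
      SCAD.WithProbTendingToOne P (fun n => {ω |
        SCAD.IsStrictLocalMin
          (SCAD.objective a (lam n) (SCAD.design x n ω) (SCAD.response x ε β n ω))
          (βhat n (SCAD.design x n ω, SCAD.response x ε β n ω)) ∧
        SCAD.model (βhat n (SCAD.design x n ω, SCAD.response x ε β n ω)) =
          SCAD.model (β n)}) ∧
      Integrable (fun e : ℝ => e ^ 4) ν ∧
      TendstoInDistribution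
        (fun (n : ℕ) (ω : Ω n) => √(n : ℝ) *
          (SCAD.plugInVariance (SCAD.design x n ω) (SCAD.response x ε β n ω)
            (βhat n (SCAD.design x n ω, SCAD.response x ε β n ω)) - σ ^ 2))
        atTop (fun z : ℝ => z) P
        (gaussianReal 0 (Real.toNNReal (∫ e, e ^ 4 ∂ν - σ ^ 4))) := by
  have h4 : Integrable (fun e : ℝ => e ^ 4) ν := by
    rcases htail with ⟨-, h⟩ | ⟨α, θ, -, hθ, -, -, h⟩
    · exact SCAD.integrable_pow_four_of_errorExpMoment one_pos h
    · exact SCAD.integrable_pow_four_of_errorExpMoment hθ h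
  have hmgf : ∃ K t₀ : ℝ, 0 < K ∧ 0 < t₀ ∧ ∀ n j t, |t| ≤ t₀ →
      ∫⁻ ω, ENNReal.ofReal (Real.exp (t * ∑ i, x n i ω j * ε n i ω)) ∂(P n) ≤
        ENNReal.ofReal (Real.exp (n * (K * t ^ 2))) := by
    rcases htail with ⟨hx, hε⟩ | ⟨α, θ, hα, hθ, hαθ, hx, hε⟩
    · exact SCAD.exists_expMoment_bound_of_boundedDesign herr hx hε
    · exact SCAD.exists_expMoment_bound_of_randomDesign herr hα hθ hαθ hx hε
  have hmain := SCAD.withProbTendingToOne_oracle ha hα₀ hp hs herr h4 hmgf hdesign htuning hα₀'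
  exact ⟨fun n => SCAD.oracleEstimator (SCAD.model (β n)),
    fun n => SCAD.measurable_oracleEstimator _, hmain.mono fun n ω h => h.1, h4,
    SCAD.tendstoInDistribution_plugInVariance_oracle hα₀' hs herr h4
      (hmain.mono fun n ω h => ⟨h.1.2, h.2⟩)⟩
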